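/- **Setting.** Let $m,r\ge 1$, $n\ge 0$, and for $i=1,\dots,m$ let $f_i,g_i:\mathbb R^n\times\mathbb R^r\to\mathbb R$. For a family $(v_i)_{i=1}^m$ write $\bar v=\frac1m\sum_i v_i$; $\|\cdot\|$ is the Euclidean norm of vectors and the spectral norm of matrices. Put $f=\frac1m\sum_i f_i$, $g=\frac1m\sum_i g_i$, $$y^*(x)=\arg\min_y g(x,y),\qquad \Phi(x)=f(x,y^*(x)),\qquad y^*(x;\lambda)=\arg\min_y \frac1m\sum_{i=1}^m\big(f_i(x,y)+\lambda(g_i(x,y)-g_i(x,y^*(x)))\big).$$ **Assumptions.** 1. Each $f_i$ is $C^1$ and $\nabla f_i$ is $L_{f,1}$-Lipschitz jointly in $(x,y)$; $\|\nabla_y f_i(x,y^*(x))\|\le C_{f,y}$ for all $x$. 2. Each $g_i(x,\cdot)$ is $\mu_g$-strongly convex with $\mu_g>0$; each $g_i$ is $C^2$, $\nabla g_i$ is $L_{g,1}$-Lipschitz and $\nabla^2 g_i$ is $L_{g,2}$-Lipschitz jointly in $(x,y)$. 3. The undirected graph on $\{1,\dots,m\}$ is connected; $W=(w_{ij})$ is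 symmetric and doubly stochastic, $w_{ij}>0$ if $i=j$ or $\{i,j\}$ is an edge, and $w_{ij}=0$ otherwise. Put $\rho=\|W-\frac1m 1_m1_m^{\rm T}\|^2$. 4. For all $x$, at the point $(x,y^*(x))$: $\frac1m\sum_i\|\nabla_x f_i-\nabla_x f\|^2\le b_f^2$, $\frac1m\sum_i\|\nabla_y f_i-\nabla_y f\|^2\le b_f^2$, and the same for $g_i,g$ with $b_g^2$. **Algorithm.** Let $\lambda>2L_{f,1}/\mu_g$ and $\alpha,\beta,\gamma>0$. From arbitrary $x_i^0\in\mathbb R^n$, $y_i^0,z_i^0\in\mathbb R^r$, iterate $$z_i^{k+1}=\sum_j w_{ij}z_j^k-\gamma\nabla_y g_i(x_i^k,z_i^k),\qquad y_i^{k+1}=\sum_j w_{ij}y_j^k-\beta\big(\nabla_y f_i(x_i^k,y_i^k)+\lambda\nabla_y g_i(x_i^k,y_i^k)\big),$$ $$x_i^{k+1}=\sum_j w_{ij}x_j^k-\alpha\big(\nabla_x f_i(x_i^k,y_i^k)+\lambda(\nabla_x g_i(x_i^k,y_i^k)-\nabla_x g_i(x_i^k,z_i^k))\big).$$ **Constants.**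 $L_{y^*}=\frac{L_{g,1}}{\mu_g}$, $L=\big(L_{f,1}+\frac{L_{f,1}L_{g,2}}{\mu_g}+\frac{C_{f,y}L_{g,2}}{\mu_g}+\frac{C_{f,y}L_{g,2}^2}{\mu_g^2}\big)(1+L_{y^*})$, $C_{\rm in}=\frac{2C_{f,y}}{\mu_g}$, $C_{\rm ou}=C_{\rm in}\big(1+\frac{L_{g,1}}{\mu_g}\big)\big(L_{f,1}+\frac{L_{g,2}C_{\rm in}}2\big)$, $\mu_\lambda=\frac{\lambda\mu_g}2$, $L_\lambda=L_{f,1}+\lambda L_{g,1}$, $U_\lambda^2=L_{f,1}^2+\lambda^2L_{g,1}^2$, $w_\gamma=\frac12\frac{\mu_gL_{g,1}}{\mu_g+L_{g,1}}$, $w_\beta=\frac12\frac{\mu_\lambda L_\lambda}{\mu_\lambda+L_\lambda}$, $u_\beta=\frac{\mu_g}{4L_{g,1}}$, and $$p_1=\Big(\frac{96L_{g,1}^2}{w_\gamma^2}+\frac{96}{u_\beta^2}+24\Big)L_{g,1}^2,\quad p_2=\Big(\frac{96}{u_\beta^2}+24\Big)L_{g,1}^2,\quad p_3=\Big(\frac{48}{u_\beta^2}+12\Big)L_{g,1}^2.$$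 **Potential.** $$V^k=2\Phi(\bar x^k)+\frac{12U_\lambda^2\alpha}{w_\beta\beta}\|\bar y^k-y^*(\bar x^k;\lambda)\|^2+\frac{12L_{g,1}^2\lambda^2\alpha}{w_\gamma\gamma}\|\bar z^k-y^*(\bar x^k)\|^2+\frac{4\alpha\lambda^2}{1-\rho}\cdot\frac1m\sum_{i=1}^m\Big(p_1\|x_i^k-\bar x^k\|^2+p_3\|y_i^k-\bar y^k\|^2+p_3\|z_i^k-\bar z^k\|^2\Big).$$ **Step sizes.** $$\alpha<\min\Big\{\frac1{2L},\frac{(1-\rho)^{2/3}}{8\lambda^{2/3}p_1^{1/3}},\frac{w_\gamma\gamma}{16L_{y^*}L_{g,1}\lambda},\frac{\mu_g^2}{80L_{g,1}^2}\beta,\frac{1-\rho}{5\lambda\sqrt{p_1}},\frac{(1-\rho)\sqrt{p_3}}{32L_{g,1}\lambda\sqrt{p_1}},\frac{1-\rho}{54L_{g,1}\lambda}\Big\},$$ $$\beta<\min\Big\{\frac1{\lambda L_{g,1}},\frac12\frac1{L_{f,1}+\lambda L_{g,1}}+\frac1{\lambda\mu_g},\frac{1-\rho}{10\lambda\sqrt{p_2}},\frac{(1-\rho)\sqrt{p_1}}{48L_{g,1}\lambda\sqrt{p_2}},\frac{1-\rho}{32L_{g,1}\lambda}\Big\},$$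 $$\gamma<\min\Big\{\frac2{\mu_g+L_{g,1}},\frac12\frac{\mu_g+L_{g,1}}{\mu_gL_{g,1}},\frac{1-\rho}{8\sqrt{p_3}},\frac{(1-\rho)\sqrt{p_1}}{24L_{g,1}\sqrt{p_3}},\frac{1-\rho}{16L_{g,1}}\Big\}$$ (with $\frac1{2L}=+\infty$ if $L=0$). **Theorem.** Under Assumptions 1–4 and these step-size conditions, $\Phi$ is differentiable, and for every $K\ge1$ $$\frac1K\sum_{k=0}^{K-1}\|\nabla\Phi(\bar x^k)\|^2\le\frac{V^0-V^K}{\alpha K}+\mathcal C^2+\mathcal B^2,$$ where $$\mathcal C^2=\frac{2C_{\rm ou}^2}{\lambda^2}+\frac{864C_{\rm in}^2L_{g,1}^2p_1\lambda^2\alpha^2}{(1-\rho)^2}+\frac{576C_{\rm in}^2L_{g,1}^2p_2\lambda^2\beta^2}{(1-\rho)^2},$$ $$\mathcal B^2=\frac{24p_1\lambda^2\alpha^2}{(1-\rho)^2}b_f^2+\frac{48p_2\lambda^2\beta^2}{(1-\rho)^2}\big(b_f^2+\lambda^2b_g^2\big)+\frac{24p_3\lambda^2\gamma^2}{(1-\rho)^2}b_g^2.$$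 -/

import Mathlib

open scoped Gradient

noncomputable section

namespace AHEAD

/-- `ℝ^d` with the Euclidean norm. -/
abbrev Vec (d : ℕ) := EuclideanSpace ℝ (Fin d)

/-- The average over the `m` nodes, `(1/m) ∑ i, v i` (of vectors or of real numbers). -/
def avg {m : ℕ} {X : Type*} [AddCommGroup X] [Module ℝ X] (v : Fin m → X) : X :=
  (m : ℝ)⁻¹ • ∑ i, v i

/-- `φ(x, y)` as a function on `ℝ^n × ℝ^r = ℝ^(n+r)` with the Euclidean norm. -/
def joint {n r : ℕ} (φ : Vec n → Vec r → ℝ) : WithLp 2 (Vec n × Vec r) → ℝ :=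
  fun p => φ p.fst p.snd

/-- The partial gradient `∇_x φ(x, y)`. -/
def gradX {n r : ℕ} (φ : Vec n → Vec r → ℝ) (x : Vec n) (y : Vec r) : Vec n :=
  ∇ (fun x' => φ x' y) x

/-- The partial gradient `∇_y φ(x, y)`. -/
def gradY {n r : ℕ} (φ : Vec n → Vec r → ℝ) (x : Vec n) (y : Vec r) : Vec r :=
  ∇ (fun y' => φ x y') y

/-- `h(x, y) = (1/m) ∑ i, h_i(x, y)`. -/
def meanFun {m n r : ℕ} (h : Fin m → Vec n → Vec r → ℝ) (x : Vec n) (y : Vec r) : ℝ :=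
  avg fun i => h i x y

/-- A global minimizer of `φ` (arbitrary if there is none). -/
def argmin {r : ℕ} (φ : Vec r → ℝ) : Vec r :=
  Classical.epsilon fun y => ∀ y', φ y ≤ φ y'

/-- `φ` is continuously differentiable and its gradient is `L`-Lipschitz, jointly in `(x, y)`. -/
def IsSmooth {n r : ℕ} (L : ℝ) (φ : Vec n → Vec r → ℝ) : Prop :=
  ContDiff ℝ 1 (joint φ) ∧ ∀ u v, ‖∇ (joint φ) u - ∇ (joint φ) v‖ ≤ L * ‖u - v‖

/-- `φ` is twice continuously differentiable and its Hessian is `L`-Lipschitz in operator norm,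
jointly in `(x, y)`. -/
def HasLipschitzHessian {n r : ℕ} (L : ℝ) (φ : Vec n → Vec r → ℝ) : Prop :=
  ContDiff ℝ 2 (joint φ) ∧
    ∀ u v, ‖fderiv ℝ (∇ (joint φ)) u - fderiv ℝ (∇ (joint φ)) v‖ ≤ L * ‖u - v‖

/-- `δ²`-bounded heterogeneity of `{∇_x h_i}` at the point `(x, y)`. -/
def HetX {m n r : ℕ} (h : Fin m → Vec n → Vec r → ℝ) (δ : ℝ) (x : Vec n) (y : Vec r) : Prop :=
  (avg fun i => ‖gradX (h i) x y - gradX (meanFun h) x y‖ ^ 2) ≤ δ ^ 2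

/-- `δ²`-bounded heterogeneity of `{∇_y h_i}` at the point `(x, y)`. -/
def HetY {m n r : ℕ} (h : Fin m → Vec n → Vec r → ℝ) (δ : ℝ) (x : Vec n) (y : Vec r) : Prop :=
  (avg fun i => ‖gradY (h i) x y - gradY (meanFun h) x y‖ ^ 2) ≤ δ ^ 2

/-- The local outer-level functions `f_i` and inner-level functions `g_i` of the `m` nodes. -/
structure Problem (m n r : ℕ) where
  f : Fin m → Vec n → Vec r → ℝ
  g : Fin m → Vec n → Vec r → ℝ

namespace Problem

variable {m n r : ℕ} (P : Problem m n r)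

/-- `y*(x) = argmin_y g(x, y)`. -/
def yStar (x : Vec n) : Vec r := argmin (meanFun P.g x)

/-- `Φ(x) = (1/m) ∑ i, f_i(x, y*(x))`. -/
def Phi (x : Vec n) : ℝ := meanFun P.f x (P.yStar x)

/-- The penalty function
`p(x, y; lam) = (1/m) ∑ i, (f_i(x, y) + lam (g_i(x, y) - g_i(x, y*(x))))`. -/
def penalty (lam : ℝ) (x : Vec n) (y : Vec r) : ℝ :=
  avg fun i => P.f i x y + lam * (P.g i x y - P.g i x (P.yStar x))

/-- `y*(x; lam) = argmin_y p(x, y; lam)`. -/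
def yStarPen (lam : ℝ) (x : Vec n) : Vec r := argmin (P.penalty lam x)

end Problem

/-- The constants of the problem: `f_i` is `Lf1`-smooth, `‖∇_y f_i(x, y*(x))‖ ≤ Cfy`, `g_i` is
`μg`-strongly convex in `y` and `Lg1`-smooth with `Lg2`-Lipschitz Hessian, and the heterogeneity
bounds are `bf ^ 2` and `bg ^ 2`. -/
structure Constants where
  Lf1 : ℝ
  Cfy : ℝ
  μg : ℝ
  Lg1 : ℝ
  Lg2 : ℝ
  bf : ℝ
  bg : ℝ

/-- Outer-level functions. -/
structure OuterAssumption {m n r : ℕ} (P : Problem m n r) (c : Constants) : Prop where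
  smooth : ∀ i, IsSmooth c.Lf1 (P.f i)
  bounded : ∀ i x, ‖gradY (P.f i) x (P.yStar x)‖ ≤ c.Cfy

/-- Inner-level functions. -/
structure InnerAssumption {m n r : ℕ} (P : Problem m n r) (c : Constants) : Prop where
  μg_pos : 0 < c.μg
  strongConvex : ∀ i x, StrongConvexOn Set.univ c.μg (P.g i x)
  smooth : ∀ i, IsSmooth c.Lg1 (P.g i)
  hessian : ∀ i, HasLipschitzHessian c.Lg2 (P.g i)

/-- The network is connected, and the symmetric doubly stochastic weight matrix `W` is positive
exactly on the edges and on the diagonal (every node counts as a neighbour of itself). -/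
structure NetworkAssumption {m : ℕ} (G : SimpleGraph (Fin m)) (W : Matrix (Fin m) (Fin m) ℝ) :
    Prop where
  connected : G.Connected
  symm : ∀ i j, W i j = W j i
  pos : ∀ i j, (i = j ∨ G.Adj i j) → 0 < W i j
  zero : ∀ i j, ¬ (i = j ∨ G.Adj i j) → W i j = 0
  doublyStochastic : W ∈ doublyStochastic ℝ (Fin m)

/-- Bounded heterogeneity at the points `(x, y*(x))`. -/
structure HeterogeneityAssumption {m n r : ℕ} (P : Problem m n r) (c : Constants) : Prop where
  fx : ∀ x, HetX P.f c.bf x (P.yStar x)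
  fy : ∀ x, HetY P.f c.bf x (P.yStar x)
  gx : ∀ x, HetX P.g c.bg x (P.yStar x)
  gy : ∀ x, HetY P.g c.bg x (P.yStar x)

/-- `ρ = ‖W - 1 1ᵀ / m‖²`, with the spectral norm. -/
def rho {m : ℕ} (W : Matrix (Fin m) (Fin m) ℝ) : ℝ :=
  ‖Matrix.toEuclideanCLM (n := Fin m) (𝕜 := ℝ)
    (W - Matrix.of fun _ _ => (m : ℝ)⁻¹)‖ ^ 2

/-- The penalty parameter `lam` and the step sizes `α`, `β`, `γ`. -/
structure Tuning where
  lam : ℝ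
  α : ℝ
  β : ℝ
  γ : ℝ

/-- The stacked variables `x = {x_i}`, `y = {y_i}`, `z = {z_i}`. -/
structure State (m n r : ℕ) where
  x : Fin m → Vec n
  y : Fin m → Vec r
  z : Fin m → Vec r

/-- `h_{x,i} = ∇_x f_i(x_i, y_i) + lam (∇_x g_i(x_i, y_i) - ∇_x g_i(x_i, z_i))`. -/
def hx {m n r : ℕ} (P : Problem m n r) (lam : ℝ) (s : State m n r) (i : Fin m) : Vec n :=
  gradX (P.f i) (s.x i) (s.y i) +
    lam • (gradX (P.g i) (s.x i) (s.y i) - gradX (P.g i) (s.x i) (s.z i))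

/-- `h_{y,i} = ∇_y f_i(x_i, y_i) + lam ∇_y g_i(x_i, y_i)`. -/
def hy {m n r : ℕ} (P : Problem m n r) (lam : ℝ) (s : State m n r) (i : Fin m) : Vec r :=
  gradY (P.f i) (s.x i) (s.y i) + lam • gradY (P.g i) (s.x i) (s.y i)

/-- `h_{z,i} = ∇_y g_i(x_i, z_i)`. -/
def hz {m n r : ℕ} (P : Problem m n r) (s : State m n r) (i : Fin m) : Vec r :=
  gradY (P.g i) (s.x i) (s.z i)

/-- One iteration of the algorithm. -/
def step {m n r : ℕ} (P : Problem m n r) (W : Matrix (Fin m) (Fin m) ℝ) (t : Tuning)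
    (s : State m n r) : State m n r where
  x i := (∑ j, W i j • s.x j) - t.α • hx P t.lam s i
  y i := (∑ j, W i j • s.y j) - t.β • hy P t.lam s i
  z i := (∑ j, W i j • s.z j) - t.γ • hz P s i

/-- The iterates `(x^k, y^k, z^k)` started at `s₀`. -/
def iter {m n r : ℕ} (P : Problem m n r) (W : Matrix (Fin m) (Fin m) ℝ) (t : Tuning)
    (s₀ : State m n r) : ℕ → State m n r
  | 0 => s₀
  | k + 1 => step P W t (iter P W t s₀ k)

/-- The averaged consensus error `(1/m) ‖v - 1_m ⊗ v̄‖² = (1/m) ∑ i, ‖v_i - v̄‖²`. -/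
def consensusError {m d : ℕ} (v : Fin m → Vec d) : ℝ :=
  avg fun i => ‖v i - avg v‖ ^ 2

namespace Constants

variable (c : Constants)

/-- `L_{y*} = L_{g,1} / μ_g`. -/
def LyStar : ℝ := c.Lg1 / c.μg

/-- The constant `L` that bounds the step size `α`. -/
def L : ℝ :=
  (c.Lf1 + c.Lf1 * c.Lg2 / c.μg + c.Cfy * c.Lg2 / c.μg + c.Cfy * c.Lg2 ^ 2 / c.μg ^ 2) *
    (1 + c.LyStar)

/-- `C_in = 2 C_{f,y} / μ_g`. -/
def Cin : ℝ := 2 * c.Cfy / c.μg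

/-- `C_ou = C_in (1 + L_{g,1} / μ_g) (L_{f,1} + L_{g,2} C_in / 2)`. -/
def Cou : ℝ := c.Cin * (1 + c.Lg1 / c.μg) * (c.Lf1 + c.Lg2 * c.Cin / 2)

/-- `μ_λ = λ μ_g / 2`. -/
def μlam (lam : ℝ) : ℝ := lam * c.μg / 2

/-- `L_λ = L_{f,1} + λ L_{g,1}`. -/
def Llam (lam : ℝ) : ℝ := c.Lf1 + lam * c.Lg1

/-- `U_λ² = L_{f,1}² + λ² L_{g,1}²`. -/
def Usq (lam : ℝ) : ℝ := c.Lf1 ^ 2 + lam ^ 2 * c.Lg1 ^ 2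

/-- `w_γ = (1/2) μ_g L_{g,1} / (μ_g + L_{g,1})`. -/
def wγ : ℝ := 1 / 2 * (c.μg * c.Lg1 / (c.μg + c.Lg1))

/-- `w_β = (1/2) μ_λ L_λ / (μ_λ + L_λ)`. -/
def wβ (lam : ℝ) : ℝ := 1 / 2 * (c.μlam lam * c.Llam lam / (c.μlam lam + c.Llam lam))

/-- `u_β = μ_g / (4 L_{g,1})`. -/
def uβ : ℝ := c.μg / (4 * c.Lg1)

def p1 : ℝ := (96 * c.Lg1 ^ 2 / c.wγ ^ 2 + 96 / c.uβ ^ 2 + 24) * c.Lg1 ^ 2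

def p2 : ℝ := (96 / c.uβ ^ 2 + 24) * c.Lg1 ^ 2

def p3 : ℝ := (48 / c.uβ ^ 2 + 12) * c.Lg1 ^ 2

end Constants

/-- The potential function `V` at a state. -/
def potential {m n r : ℕ} (P : Problem m n r) (c : Constants) (ρ : ℝ) (t : Tuning)
    (s : State m n r) : ℝ :=
  2 * P.Phi (avg s.x)
    + 12 * c.Usq t.lam * t.α / (c.wβ t.lam * t.β) * ‖avg s.y - P.yStarPen t.lam (avg s.x)‖ ^ 2
    + 12 * c.Lg1 ^ 2 * t.lam ^ 2 * t.α / (c.wγ * t.γ) * ‖avg s.z - P.yStar (avg s.x)‖ ^ 2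
    + 4 * c.p1 * t.α * t.lam ^ 2 / (1 - ρ) * consensusError s.x
    + 4 * c.p3 * t.α * t.lam ^ 2 / (1 - ρ) * consensusError s.y
    + 4 * c.p3 * t.α * t.lam ^ 2 / (1 - ρ) * consensusError s.z

/-- The step-size conditions. The condition `α < 1 / (2 L)` is written `2 L α < 1`, so that it
holds trivially, as it should, if `L = 0`. -/
structure StepSizeConditions (c : Constants) (ρ : ℝ) (t : Tuning) : Prop where
  α_pos : 0 < t.α
  β_pos : 0 < t.β
  γ_pos : 0 < t.γ
  α_lt₁ : 2 * c.L * t.α < 1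
  α_lt₂ : t.α < (1 - ρ) ^ (2 / 3 : ℝ) / (8 * t.lam ^ (2 / 3 : ℝ) * c.p1 ^ (1 / 3 : ℝ))
  α_lt₃ : t.α < c.wγ * t.γ / (16 * c.LyStar * c.Lg1 * t.lam)
  α_lt₄ : t.α < c.μg ^ 2 / (80 * c.Lg1 ^ 2) * t.β
  α_lt₅ : t.α < (1 - ρ) / (5 * t.lam * √c.p1)
  α_lt₆ : t.α < (1 - ρ) * √c.p3 / (32 * c.Lg1 * t.lam * √c.p1)
  α_lt₇ : t.α < (1 - ρ) / (54 * c.Lg1 * t.lam)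
  β_lt₁ : t.β < 1 / (t.lam * c.Lg1)
  β_lt₂ : t.β < 1 / 2 * (1 / (c.Lf1 + t.lam * c.Lg1)) + 1 / (t.lam * c.μg)
  β_lt₃ : t.β < (1 - ρ) / (10 * t.lam * √c.p2)
  β_lt₄ : t.β < (1 - ρ) * √c.p1 / (48 * c.Lg1 * t.lam * √c.p2)
  β_lt₅ : t.β < (1 - ρ) / (32 * c.Lg1 * t.lam)
  γ_lt₁ : t.γ < 2 / (c.μg + c.Lg1)
  γ_lt₂ : t.γ < 1 / 2 * ((c.μg + c.Lg1) / (c.μg * c.Lg1))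
  γ_lt₃ : t.γ < (1 - ρ) / (8 * √c.p3)
  γ_lt₄ : t.γ < (1 - ρ) * √c.p1 / (24 * c.Lg1 * √c.p3)
  γ_lt₅ : t.γ < (1 - ρ) / (16 * c.Lg1)

/-- The penalty errors `𝒞²`. -/
def penaltyErrors (c : Constants) (ρ : ℝ) (t : Tuning) : ℝ :=
  2 * c.Cou ^ 2 / t.lam ^ 2
    + 864 * c.Cin ^ 2 * c.Lg1 ^ 2 * c.p1 * t.lam ^ 2 * t.α ^ 2 / (1 - ρ) ^ 2
    + 576 * c.Cin ^ 2 * c.Lg1 ^ 2 * c.p2 * t.lam ^ 2 * t.β ^ 2 / (1 - ρ) ^ 2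

/-- The heterogeneity errors `ℬ²`. -/
def heterogeneityErrors (c : Constants) (ρ : ℝ) (t : Tuning) : ℝ :=
  24 * c.p1 * t.lam ^ 2 * t.α ^ 2 / (1 - ρ) ^ 2 * c.bf ^ 2
    + 48 * c.p2 * t.lam ^ 2 * t.β ^ 2 / (1 - ρ) ^ 2 * (c.bf ^ 2 + t.lam ^ 2 * c.bg ^ 2)
    + 24 * c.p3 * t.lam ^ 2 * t.γ ^ 2 / (1 - ρ) ^ 2 * c.bg ^ 2

end AHEAD

end

/-! The proof is a Lyapunov argument. One iteration changes the potential by at most α(−‖∇Φ(x̄)‖² +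
𝒞² + ℬ²) (`potential_step_le`), and the sum over k telescopes. Since W is doubly stochastic it
disappears from the averaged recursions, so x̄, ȳ, z̄ take inexact gradient steps. Their errors are
the tracking errors of ȳ and z̄, the consensus errors, and the bias of the penalty.

Write κ = L_{g,1}/μ_g. The map y* has the derivative D = −(∇²_yy g)⁻¹∇²_yx g with a quadratic
remainder (`exists_sensitivity`), hence ∇Φ = ∇_x f + Dᵀ∇_y f. The penalty gradient differs from ∇Φ
by at most C_ou/λ (`norm_penHyperGrad_sub_le`): tested against (w, Dw), the first-order variation of
∇g vanishes, so the factor λ meets only a Taylor remainder that is quadratic in the distance O(1/λ)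
between the two minimizers.

The descent estimate (`hyperobjective_descent`) expands Φ at the current point only. The remainder
of y* contributes a curvature C_{f,y}L_{g,2}(1+κ²)/μ_g. If α times it is at most 1/8, the term
−½‖d‖² absorbs it. Otherwise C_ou/λ exceeds a multiple of κC_{f,y}, and crude first-order bounds
suffice.

The tracking errors contract by cocoercivity and strong monotonicity; they are perturbed by
consensus errors and by the drift of the minimizers, which is O(α‖d‖) (`lower_tracking`,
`penalty_tracking`). The consensus errors contract by mixing; they are fed by the spread of the
local directions, which is heterogeneity at (x̄, y*(x̄)) plus Lipschitz terms
(`consensusError_mixing_sub_le`, `avg_hx_sub_sq_le` and its analogues). The weights in the potential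
make every error coefficient nonpositive (`error_balance`). -/

namespace AHEAD

/-! ### Taylor bounds, strong convexity and cocoercivity -/

section Analysis

variable {E F : Type*} [NormedAddCommGroup E] [NormedSpace ℝ E]
  [NormedAddCommGroup F] [NormedSpace ℝ F]

/-- First-order Taylor expansion with Lipschitz derivative. -/
theorem norm_taylor_le_of_lipschitz {f : E → F} {f' : E → E →L[ℝ] F} {L : ℝ}
    (hf : ∀ x, HasFDerivAt f (f' x) x) (hL : ∀ x y, ‖f' x - f' y‖ ≤ L * ‖x - y‖) (x y : E) :
    ‖f y - f x - f' x (y - x)‖ ≤ L / 2 * ‖y - x‖ ^ 2 := by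
  set d := y - x with hd
  have hγ : ∀ t : ℝ, HasDerivAt (fun t : ℝ => x + t • d) d t := fun t => by
    simpa using ((hasDerivAt_id t).smul_const d).const_add x
  have h1 : ∀ t : ℝ, HasDerivAt (fun t : ℝ => f (x + t • d) - f x - t • f' x d)
      (f' (x + t • d) d - f' x d) t := fun t => by
    have := ((hf (x + t • d)).comp_hasDerivAt t (hγ t)).sub_const (f x)
    exact (this.sub ((hasDerivAt_id t).smul_const (f' x d))).congr_deriv (by simp)
  have h2 : ∀ t : ℝ, HasDerivAt (fun t : ℝ => L / 2 * ‖d‖ ^ 2 * t ^ 2) (L * ‖d‖ ^ 2 * t) t :=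
    fun t => by
      refine ((hasDerivAt_pow 2 t).const_mul (L / 2 * ‖d‖ ^ 2)).congr_deriv ?_
      push_cast; ring
  have := image_norm_le_of_norm_deriv_right_le_deriv_boundary (a := 0) (b := 1)
    (fun t _ => (h1 t).continuousAt.continuousWithinAt) (fun t _ => (h1 t).hasDerivWithinAt)
    (by simp) h2 (fun t ht => by
      rw [← sub_apply]
      refine (ContinuousLinearMap.le_opNorm _ _).trans ?_
      have := mul_le_mul_of_nonneg_right (hL (x + t • d) x) (norm_nonneg d)
      refine this.trans (le_of_eq ?_)
      rw [add_sub_cancel_left, norm_smul, Real.norm_of_nonneg ht.1]; ring)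
    (Set.right_mem_Icc.2 zero_le_one)
  simpa [hd] using this

end Analysis

section Hilbert

variable {F : Type*} [NormedAddCommGroup F] [InnerProductSpace ℝ F] [CompleteSpace F]
  {φ : F → ℝ} {G : F → F} {L μ : ℝ}

local notation "⟪" x ", " y "⟫" => inner ℝ x y

theorem hasDerivAt_line (hφ : ∀ y, HasGradientAt φ (G y) y) (x d : F) (t : ℝ) :
    HasDerivAt (fun t : ℝ => φ (x + t • d)) ⟪G (x + t • d), d⟫ t := by
  have hγ : HasDerivAt (fun t : ℝ => x + t • d) d t := by
    simpa using ((hasDerivAt_id t).smul_const d).const_add x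
  exact ((hφ (x + t • d)).hasFDerivAt.comp_hasDerivAt t hγ).congr_deriv (by simp)

theorem abs_taylor_le_of_lipschitz_gradient (hφ : ∀ y, HasGradientAt φ (G y) y)
    (hL : ∀ x y, ‖G x - G y‖ ≤ L * ‖x - y‖) (x y : F) :
    |φ y - φ x - ⟪G x, y - x⟫| ≤ L / 2 * ‖y - x‖ ^ 2 := by
  have := norm_taylor_le_of_lipschitz (f := φ) (f' := fun x => InnerProductSpace.toDual ℝ F (G x))
    (L := L) (fun x => (hφ x).hasFDerivAt)
    (fun x y => by rw [← map_sub, LinearIsometryEquiv.norm_map]; exact hL x y) x y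
  simpa using this

/-- Strong convexity gives the quadratic lower bound at the tangent. -/
theorem StrongConvexOn.add_inner_gradient_le (hφ : ∀ y, HasGradientAt φ (G y) y)
    (h : StrongConvexOn Set.univ μ φ) (x y : F) :
    φ x + ⟪G x, y - x⟫ + μ / 2 * ‖y - x‖ ^ 2 ≤ φ y := by
  set d := y - x with hd
  have h1 := hasDerivAt_line hφ x d 0
  rw [zero_smul, add_zero] at h1
  have h2 := h1.tendsto_slope_zero_right
  have h3 : Filter.Tendsto (fun t : ℝ => φ y - φ x - (1 - t) * (μ / 2 * ‖d‖ ^ 2))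
      (nhdsWithin 0 (Set.Ioi 0)) (nhds (φ y - φ x - (1 - 0) * (μ / 2 * ‖d‖ ^ 2))) :=
    (Continuous.tendsto (by fun_prop) 0).mono_left nhdsWithin_le_nhds
  -- Strong convexity on the segment, divided by t, bounds the difference quotient; t → 0+ turns it
  -- into the directional derivative.
  have h4 := le_of_tendsto_of_tendsto h2 h3 (by
    filter_upwards [Ioo_mem_nhdsGT (zero_lt_one (α := ℝ))] with t ht
    have := h.2 (Set.mem_univ x) (Set.mem_univ y) (sub_nonneg.2 ht.2.le) ht.1.le (by ring)
    have e : (1 - t) • x + t • y = x + t • d := by rw [hd]; module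
    rw [e, norm_sub_rev, ← hd] at this
    simp only [smul_eq_mul, zero_add, zero_smul, add_zero] at this ⊢
    rw [inv_mul_le_iff₀ ht.1]
    nlinarith [this])
  linarith

theorem StrongConvexOn.strong_monotone (hφ : ∀ y, HasGradientAt φ (G y) y)
    (h : StrongConvexOn Set.univ μ φ) (x y : F) :
    μ * ‖x - y‖ ^ 2 ≤ ⟪G x - G y, x - y⟫ := by
  have h1 := StrongConvexOn.add_inner_gradient_le hφ h x y
  have h2 := StrongConvexOn.add_inner_gradient_le hφ h y x
  have e : ⟪G x, y - x⟫ = -⟪G x, x - y⟫ := by rw [← inner_neg_right, neg_sub]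
  rw [norm_sub_rev, e] at h1
  rw [inner_sub_left]
  linarith

/-- Along the segment the derivative of φ dominates that of the quadratic. The hypothesis concerns
the gradient alone, so that it also serves the penalized objective, for which only monotonicity of
the gradient is derived. -/
theorem add_inner_gradient_le_of_strong_monotone (hφ : ∀ y, HasGradientAt φ (G y) y)
    (h : ∀ x y, μ * ‖x - y‖ ^ 2 ≤ ⟪G x - G y, x - y⟫) (x y : F) :
    φ x + ⟪G x, y - x⟫ + μ / 2 * ‖y - x‖ ^ 2 ≤ φ y := by
  set d := y - x with hd
  have h1 : ∀ t : ℝ, HasDerivAt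
      (fun t : ℝ => φ x + t * ⟪G x, d⟫ + μ / 2 * ‖d‖ ^ 2 * t ^ 2)
      (⟪G x, d⟫ + μ * ‖d‖ ^ 2 * t) t := fun t => by
    refine (((hasDerivAt_id t).mul_const ⟪G x, d⟫).const_add (φ x) |>.add
      ((hasDerivAt_pow 2 t).const_mul (μ / 2 * ‖d‖ ^ 2))).congr_deriv ?_
    push_cast; ring
  have := image_le_of_deriv_right_le_deriv_boundary (a := 0) (b := 1)
    (fun t _ => (h1 t).continuousAt.continuousWithinAt) (fun t _ => (h1 t).hasDerivWithinAt)
    (by simp)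
    (fun t _ => (hasDerivAt_line hφ x d t).continuousAt.continuousWithinAt)
    (fun t _ => (hasDerivAt_line hφ x d t).hasDerivWithinAt)
    (fun t ht => by
      rcases eq_or_lt_of_le ht.1 with rfl | ht0
      · simp
      have := h (x + t • d) x
      rw [add_sub_cancel_left, norm_smul, Real.norm_of_nonneg ht.1, inner_smul_right,
        inner_sub_left] at this
      have h3 : t * (μ * ‖d‖ ^ 2 * t) ≤ t * (⟪G (x + t • d), d⟫ - ⟪G x, d⟫) := by
        linarith [this, show μ * (t * ‖d‖) ^ 2 = t * (μ * ‖d‖ ^ 2 * t) by ring]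
      linarith [le_of_mul_le_mul_left h3 ht0])
    (Set.right_mem_Icc.2 zero_le_one)
  simpa [hd] using this

/-- Cocoercivity of the gradient of a convex function with Lipschitz gradient. -/
theorem cocoercive_gradient (hφ : ∀ y, HasGradientAt φ (G y) y) (hL0 : 0 < L)
    (hL : ∀ x y, ‖G x - G y‖ ≤ L * ‖x - y‖) (h : ∀ x y, 0 ≤ ⟪G x - G y, x - y⟫) (x y : F) :
    ‖G x - G y‖ ^ 2 ≤ L * ⟪G x - G y, x - y⟫ := by
  have key : ∀ x y, φ x + ⟪G x, y - x⟫ + 1 / (2 * L) * ‖G y - G x‖ ^ 2 ≤ φ y := fun x y => by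
    set e := G y - G x with he
    -- At the point y − L⁻¹e the tangent at x is a lower bound and the quadratic model at y an upper
    -- bound; the step L⁻¹ along e gives the best gain, ‖e‖²/(2L).
    have h1 := add_inner_gradient_le_of_strong_monotone (μ := 0) hφ
      (fun x y => by simpa using h x y) x (y - L⁻¹ • e)
    have h2 := (le_abs_self _).trans
      (abs_taylor_le_of_lipschitz_gradient hφ hL y (y - L⁻¹ • e))
    have e1 : y - L⁻¹ • e - x = (y - x) - L⁻¹ • e := by abel
    have e2 : y - L⁻¹ • e - y = -(L⁻¹ • e) := by abel
    have e3 : ⟪G y, e⟫ - ⟪G x, e⟫ = ‖e‖ ^ 2 := by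
      rw [← inner_sub_left, ← he, real_inner_self_eq_norm_sq]
    rw [e1, inner_sub_right, inner_smul_right] at h1
    rw [e2, inner_neg_right, inner_smul_right, norm_neg, norm_smul, norm_inv,
      Real.norm_of_nonneg hL0.le] at h2
    have e4 : L / 2 * (L⁻¹ * ‖e‖) ^ 2 = 1 / (2 * L) * ‖e‖ ^ 2 := by field_simp
    have e5 : L⁻¹ * ⟪G y, e⟫ - L⁻¹ * ⟪G x, e⟫ = 2 * (1 / (2 * L) * ‖e‖ ^ 2) := by
      rw [← mul_sub, e3]; field_simp
    rw [e4] at h2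
    linarith
  have h1 := key x y
  have h2 := key y x
  have e : ⟪G x, y - x⟫ = -⟪G x, x - y⟫ := by rw [← inner_neg_right, neg_sub]
  rw [norm_sub_rev, e] at h1
  have h3 : 2 * (1 / (2 * L) * ‖G x - G y‖ ^ 2) ≤ ⟪G x - G y, x - y⟫ := by
    rw [inner_sub_left]; linarith
  have e6 : ‖G x - G y‖ ^ 2 = L * (2 * (1 / (2 * L) * ‖G x - G y‖ ^ 2)) := by field_simp
  rw [e6]
  exact mul_le_mul_of_nonneg_left h3 hL0.le

/-- Contraction of a gradient step. -/
theorem norm_gradient_step_sq_le (hφ : ∀ y, HasGradientAt φ (G y) y) (hL0 : 0 < L) (hμ : 0 ≤ μ)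
    (hL : ∀ x y, ‖G x - G y‖ ≤ L * ‖x - y‖)
    (h : ∀ x y, μ * ‖x - y‖ ^ 2 ≤ ⟪G x - G y, x - y⟫) {τ : ℝ} (hτ : 0 ≤ τ) (hτL : τ * L ≤ 2)
    (x y : F) :
    ‖(x - τ • G x) - (y - τ • G y)‖ ^ 2 ≤ (1 - (2 - τ * L) * (τ * μ)) * ‖x - y‖ ^ 2 := by
  have h1 := cocoercive_gradient hφ hL0 hL
    (fun x y => (by positivity : (0:ℝ) ≤ μ * ‖x - y‖ ^ 2).trans (h x y)) x y
  have e : (x - τ • G x) - (y - τ • G y) = (x - y) - τ • (G x - G y) := by module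
  rw [e, norm_sub_sq_real, inner_smul_right, norm_smul, Real.norm_of_nonneg hτ, mul_pow,
    real_inner_comm]
  -- Cocoercivity absorbs the quadratic term into the inner product, which keeps the factor 2 − τL ≥
  -- 0; strong monotonicity is spent only on what remains.
  have h2 := mul_le_mul_of_nonneg_left h1 (sq_nonneg τ)
  have h3 := mul_le_mul_of_nonneg_left (h x y) (mul_nonneg (sub_nonneg.2 hτL) hτ)
  linarith

end Hilbert

/-! ### Existence and stationarity of minimizers -/

section Argmin

variable {r : ℕ} {φ : Vec r → ℝ} {G : Vec r → Vec r} {μ : ℝ}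

/-- The quadratic lower bound at 0 makes φ coercive, so a minimizer exists and the choice in
`argmin` is a genuine one. -/
theorem argmin_le (hφ : ∀ y, HasGradientAt φ (G y) y) (hμ : 0 < μ)
    (h : ∀ x y, μ * ‖x - y‖ ^ 2 ≤ inner ℝ (G x - G y) (x - y)) (y : Vec r) :
    φ (argmin φ) ≤ φ y := by
  have hc : Continuous φ := continuous_iff_continuousAt.2 fun y => (hφ y).continuousAt
  have hlim : Filter.Tendsto φ (Filter.cocompact (Vec r)) Filter.atTop := by
    have h1 : ∀ y, φ 0 + ‖y‖ * (μ / 2 * ‖y‖ - ‖G 0‖) ≤ φ y := fun y => by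
      have h2 := add_inner_gradient_le_of_strong_monotone hφ h 0 y
      have h3 := (neg_le_abs _).trans (abs_real_inner_le_norm (G 0) y)
      rw [sub_zero] at h2
      nlinarith
    refine Filter.tendsto_atTop_mono h1 ?_
    refine Filter.tendsto_atTop_add_const_left _ _ ?_
    refine (tendsto_norm_cocompact_atTop (E := Vec r)).atTop_mul_atTop₀ ?_
    refine Filter.tendsto_atTop_add_const_right _ _ ?_
    exact (tendsto_norm_cocompact_atTop (E := Vec r)).const_mul_atTop (by positivity)
  exact Classical.epsilon_spec (p := fun y => ∀ y', φ y ≤ φ y') (hc.exists_forall_le hlim) y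

theorem gradient_argmin (hφ : ∀ y, HasGradientAt φ (G y) y) (hμ : 0 < μ)
    (h : ∀ x y, μ * ‖x - y‖ ^ 2 ≤ inner ℝ (G x - G y) (x - y)) : G (argmin φ) = 0 := by
  have h1 : IsLocalMin φ (argmin φ) := Filter.Eventually.of_forall (argmin_le hφ hμ h)
  simpa using h1.hasFDerivAt_eq_zero (hφ _).hasFDerivAt

end Argmin

end AHEAD

namespace AHEAD

/-! ### Averages over the nodes -/

section Avg

variable {m : ℕ}

section Module

variable {X Y : Type*} [AddCommGroup X] [Module ℝ X] [AddCommGroup Y] [Module ℝ Y]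

theorem avg_add (v w : Fin m → X) : avg (fun i => v i + w i) = avg v + avg w := by
  simp [avg, Finset.sum_add_distrib, smul_add]

theorem avg_sub (v w : Fin m → X) : avg (fun i => v i - w i) = avg v - avg w := by
  simp [avg, Finset.sum_sub_distrib, smul_sub]

theorem avg_smul (a : ℝ) (v : Fin m → X) : avg (fun i => a • v i) = a • avg v := by
  simp [avg, ← Finset.smul_sum, smul_comm a]

theorem map_avg (T : X →ₗ[ℝ] Y) (v : Fin m → X) : T (avg v) = avg fun i => T (v i) := by
  simp [avg]

theorem avg_const [NeZero m] (c : X) : avg (fun _ : Fin m => c) = c := by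
  have : (m : ℝ) ≠ 0 := NeZero.ne _
  simp only [avg, Finset.sum_const, Finset.card_univ, Fintype.card_fin]
  rw [← Nat.cast_smul_eq_nsmul ℝ, smul_smul, inv_mul_cancel₀ this, one_smul]

end Module

theorem avg_mul (a : ℝ) (v : Fin m → ℝ) : avg (fun i => a * v i) = a * avg v :=
  avg_smul a v

theorem avg_mono {v w : Fin m → ℝ} (h : ∀ i, v i ≤ w i) : avg v ≤ avg w :=
  mul_le_mul_of_nonneg_left (Finset.sum_le_sum fun i _ => h i) (by positivity)

theorem avg_nonneg {v : Fin m → ℝ} (h : ∀ i, 0 ≤ v i) : 0 ≤ avg v :=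
  mul_nonneg (by positivity) (Finset.sum_nonneg fun i _ => h i)

theorem norm_avg_le {E : Type*} [NormedAddCommGroup E] [NormedSpace ℝ E]
    (v : Fin m → E) : ‖avg v‖ ≤ avg fun i => ‖v i‖ := by
  simp only [avg, norm_smul, smul_eq_mul, norm_inv, RCLike.norm_natCast]
  gcongr
  exact norm_sum_le _ _

section Inner

variable {E : Type*} [NormedAddCommGroup E] [InnerProductSpace ℝ E]

/-- Bias-variance decomposition. -/
theorem avg_norm_sub_sq [NeZero m] (v : Fin m → E) (c : E) :
    avg (fun i => ‖v i - c‖ ^ 2) = avg (fun i => ‖v i - avg v‖ ^ 2) + ‖avg v - c‖ ^ 2 := by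
  have h : ∀ i, ‖v i - c‖ ^ 2 =
      ‖v i - avg v‖ ^ 2 + (2 * inner ℝ (avg v - c) (v i - avg v) + ‖avg v - c‖ ^ 2) := fun i => by
    rw [← sub_add_sub_cancel (v i) (avg v) c, norm_add_sq_real, real_inner_comm]; ring
  have h0 : avg (fun i => inner ℝ (avg v - c) (v i - avg v)) = 0 := by
    have := map_avg (innerₛₗ ℝ (avg v - c)) (fun i => v i - avg v)
    simp only [innerₛₗ_apply_apply] at this
    rw [← this, avg_sub, avg_const, sub_self, inner_zero_right]
  simp_rw [h]
  rw [avg_add, avg_add, avg_mul, h0, avg_const, mul_zero, zero_add]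

theorem norm_avg_sq_le [NeZero m] (v : Fin m → E) : ‖avg v‖ ^ 2 ≤ avg fun i => ‖v i‖ ^ 2 := by
  have := avg_norm_sub_sq v 0
  simp only [sub_zero] at this
  rw [this]
  exact le_add_of_nonneg_left (avg_nonneg fun i => by positivity)

theorem norm_add_sq_le_weighted {ε : ℝ} (hε : 0 < ε) (a b : E) :
    ‖a + b‖ ^ 2 ≤ (1 + ε) * ‖a‖ ^ 2 + (1 + ε⁻¹) * ‖b‖ ^ 2 := by
  rw [norm_add_sq_real]
  have h1 := real_inner_le_norm a b
  have h2 : 2 * (‖a‖ * ‖b‖) ≤ ε * ‖a‖ ^ 2 + ε⁻¹ * ‖b‖ ^ 2 := by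
    have := mul_nonneg (inv_nonneg.2 hε.le) (sq_nonneg (ε * ‖a‖ - ‖b‖))
    have e : ε⁻¹ * (ε * ‖a‖ - ‖b‖) ^ 2 =
      ε * ‖a‖ ^ 2 + ε⁻¹ * ‖b‖ ^ 2 - 2 * (‖a‖ * ‖b‖) := by field_simp; ring
    linarith
  linarith

end Inner

end Avg

/-! ### Contraction of the consensus error -/

section Mixing

variable {m d : ℕ}

theorem consensusError_nonneg (v : Fin m → Vec d) : 0 ≤ consensusError v :=
  avg_nonneg fun _ => by positivity

theorem avg_mixing {W : Matrix (Fin m) (Fin m) ℝ} (hW : W ∈ doublyStochastic ℝ (Fin m))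
    (v : Fin m → Vec d) : avg (fun i => ∑ j, W i j • v j) = avg v := by
  simp only [avg]
  congr 1
  rw [Finset.sum_comm]
  refine Finset.sum_congr rfl fun j _ => ?_
  rw [← Finset.sum_smul, sum_col_of_mem_doublyStochastic hW, one_smul]

/-- On vectors of zero sum, W acts as W − 11ᵀ/m, whose squared norm is ρ. -/
theorem sum_mixing_sq_le {W : Matrix (Fin m) (Fin m) ℝ} {a : Fin m → ℝ} (ha : ∑ i, a i = 0) :
    ∑ i, (∑ j, W i j * a j) ^ 2 ≤ rho W * ∑ i, a i ^ 2 := by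
  set T := Matrix.toEuclideanCLM (n := Fin m) (𝕜 := ℝ) (W - Matrix.of fun _ _ => (m : ℝ)⁻¹)
    with hT
  have h := T.le_opNorm (WithLp.toLp 2 a)
  have h2 := pow_le_pow_left₀ (norm_nonneg _) h 2
  rw [mul_pow, EuclideanSpace.norm_sq_eq, EuclideanSpace.norm_sq_eq] at h2
  have e : ∀ i, (T (WithLp.toLp 2 a)) i = ∑ j, W i j * a j := fun i => by
    rw [hT, Matrix.toEuclideanCLM_toLp]
    simp [Matrix.mulVec, dotProduct, sub_mul, Finset.sum_sub_distrib, ← Finset.mul_sum, ha]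
  simpa [e, rho, ← hT] using h2

/-- One round of averaging with the neighbours contracts the consensus error. -/
theorem avg_norm_mixing_sub_sq_le [NeZero m] {W : Matrix (Fin m) (Fin m) ℝ}
    (hW : W ∈ doublyStochastic ℝ (Fin m)) (v : Fin m → Vec d) :
    avg (fun i => ‖(∑ j, W i j • v j) - avg v‖ ^ 2) ≤ rho W * consensusError v := by
  have e1 : ∀ i, (∑ j, W i j • v j) - avg v = ∑ j, W i j • (v j - avg v) := fun i => by
    simp only [smul_sub, Finset.sum_sub_distrib]
    rw [← Finset.sum_smul, sum_row_of_mem_doublyStochastic hW, one_smul]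
  have e2 : ∑ j, (v j - avg v) = 0 := by
    have h : avg (fun j => v j - avg v) = 0 := by rw [avg_sub, avg_const, sub_self]
    have hm : (m : ℝ)⁻¹ ≠ 0 := inv_ne_zero (NeZero.ne _)
    exact (smul_eq_zero.1 h).resolve_left hm
  simp only [e1, consensusError]
  set w : Fin m → Vec d := fun j => v j - avg v
  change (m : ℝ)⁻¹ * ∑ i, ‖∑ j, W i j • w j‖ ^ 2 ≤ rho W * ((m : ℝ)⁻¹ * ∑ i, ‖w i‖ ^ 2)
  rw [mul_left_comm]
  refine mul_le_mul_of_nonneg_left ?_ (by positivity)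
  simp only [EuclideanSpace.norm_sq_eq, Real.norm_eq_abs, sq_abs]
  -- W mixes the nodes in each coordinate separately, so the scalar estimate applies coordinate by
  -- coordinate.
  rw [Finset.sum_comm, Finset.sum_comm (f := fun i k => (w i k) ^ 2), Finset.mul_sum]
  refine Finset.sum_le_sum fun k _ => ?_
  have hk : ∑ i, w i k = 0 := by
    have := congrArg (fun u : Vec d => u k) e2
    simpa [w] using this
  simpa using sum_mixing_sq_le (W := W) hk

theorem avg_mixing_sub {W : Matrix (Fin m) (Fin m) ℝ} (hW : W ∈ doublyStochastic ℝ (Fin m))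
    (v h : Fin m → Vec d) (τ : ℝ) :
    avg (fun i => (∑ j, W i j • v j) - τ • h i) = avg v - τ • avg h := by
  rw [avg_sub, avg_mixing hW, avg_smul]

/-- Recursion of the consensus error. -/
theorem consensusError_mixing_sub_le [NeZero m] {W : Matrix (Fin m) (Fin m) ℝ}
    (hW : W ∈ doublyStochastic ℝ (Fin m)) (hρ : rho W < 1) (v h : Fin m → Vec d) (τ : ℝ)
    (c : Vec d) :
    consensusError (fun i => (∑ j, W i j • v j) - τ • h i) ≤
      (1 + rho W) / 2 * consensusError v
        + 2 / (1 - rho W) * τ ^ 2 * avg (fun i => ‖h i - c‖ ^ 2) := by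
  have hρ0 : 0 ≤ rho W := sq_nonneg _
  set ρ := rho W with hρdef
  -- With this weight in Young's inequality, (1+ε)ρ = 2ρ/(1+ρ) ≤ (1+ρ)/2, while the noise factor
  -- 1+ε⁻¹ is exactly 2/(1−ρ).
  set ε := (1 - ρ) / (1 + ρ) with hεdef
  have hε : 0 < ε := div_pos (by linarith) (by linarith)
  have h1 : consensusError (fun i => (∑ j, W i j • v j) - τ • h i) ≤
      (1 + ε) * avg (fun i => ‖(∑ j, W i j • v j) - avg v‖ ^ 2)
        + (1 + ε⁻¹) * (τ ^ 2 * avg (fun i => ‖h i - avg h‖ ^ 2)) := by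
    rw [consensusError, avg_mixing_sub hW, ← avg_mul, ← avg_mul, ← avg_mul, ← avg_add]
    refine avg_mono fun i => ?_
    have e : (∑ j, W i j • v j) - τ • h i - (avg v - τ • avg h) =
      ((∑ j, W i j • v j) - avg v) + (-τ) • (h i - avg h) := by module
    rw [e]
    refine (norm_add_sq_le_weighted hε _ _).trans (le_of_eq ?_)
    rw [norm_smul, mul_pow, norm_neg, Real.norm_eq_abs, sq_abs]
  have h2 := avg_norm_mixing_sub_sq_le hW v
  -- The mean is the best centre, so any convenient c may replace it; later c is the mean direction
  -- at (x̄, y*(x̄)), where heterogeneity is controlled.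
  have h3 : avg (fun i => ‖h i - avg h‖ ^ 2) ≤ avg (fun i => ‖h i - c‖ ^ 2) := by
    rw [avg_norm_sub_sq h c]; exact le_add_of_nonneg_right (by positivity)
  have e1 : 1 + ε = 2 / (1 + ρ) := by rw [hεdef]; field_simp; ring
  have e2 : 1 + ε⁻¹ = 2 / (1 - ρ) := by
    have : 1 - ρ ≠ 0 := by linarith
    rw [hεdef]; field_simp; ring
  have h4 : (1 + ε) * (ρ * consensusError v) ≤ (1 + ρ) / 2 * consensusError v := by
    rw [← mul_assoc]
    refine mul_le_mul_of_nonneg_right ?_ (consensusError_nonneg v)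
    rw [e1, div_mul_eq_mul_div, div_le_div_iff₀ (by linarith) two_pos]
    nlinarith [sq_nonneg (1 - ρ)]
  have h5 : (1 + ε) * avg (fun i => ‖(∑ j, W i j • v j) - avg v‖ ^ 2) ≤
      (1 + ε) * (ρ * consensusError v) := mul_le_mul_of_nonneg_left h2 (by linarith)
  have h6 : (1 + ε⁻¹) * (τ ^ 2 * avg (fun i => ‖h i - avg h‖ ^ 2)) ≤
      2 / (1 - ρ) * τ ^ 2 * avg (fun i => ‖h i - c‖ ^ 2) := by
    rw [e2, mul_assoc]
    have : 0 ≤ 2 / (1 - ρ) := div_nonneg two_pos.le (by linarith)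
    gcongr
  linarith

end Mixing

end AHEAD

namespace AHEAD

/-! ### Derivatives of averages and symmetry of the Hessian -/

section General

theorem hasFDerivAt_avg {m : ℕ} {E F : Type*} [NormedAddCommGroup E] [NormedSpace ℝ E]
    [NormedAddCommGroup F] [NormedSpace ℝ F] {f : Fin m → E → F} {f' : Fin m → E →L[ℝ] F} {x : E}
    (hf : ∀ i, HasFDerivAt (f i) (f' i) x) :
    HasFDerivAt (fun x => avg fun i => f i x) (avg f') x :=
  (HasFDerivAt.fun_sum fun i _ => hf i).const_smul (m : ℝ)⁻¹

theorem norm_fderiv_avg_sub_le {m : ℕ} [NeZero m] {E F : Type*} [NormedAddCommGroup E]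
    [NormedSpace ℝ E] [NormedAddCommGroup F] [NormedSpace ℝ F] {f : Fin m → E → F}
    (hf : ∀ i, Differentiable ℝ (f i)) {u v : E} {b : ℝ}
    (h : ∀ i, ‖fderiv ℝ (f i) u - fderiv ℝ (f i) v‖ ≤ b) :
    ‖fderiv ℝ (fun x => avg fun i => f i x) u - fderiv ℝ (fun x => avg fun i => f i x) v‖ ≤ b := by
  rw [(hasFDerivAt_avg fun i => (hf i u).hasFDerivAt).fderiv,
    (hasFDerivAt_avg fun i => (hf i v).hasFDerivAt).fderiv, ← avg_sub]
  exact (norm_avg_le _).trans ((avg_mono h).trans (avg_const b).le)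

variable {E : Type*} [NormedAddCommGroup E] [InnerProductSpace ℝ E] [CompleteSpace E]

theorem hasGradientAt_avg {m : ℕ} {f : Fin m → E → ℝ} {f' : Fin m → E} {x : E}
    (hf : ∀ i, HasGradientAt (f i) (f' i) x) :
    HasGradientAt (fun x => avg fun i => f i x) (avg f') x := by
  rw [hasGradientAt_iff_hasFDerivAt]
  refine (hasFDerivAt_avg fun i => (hf i).hasFDerivAt).congr_fderiv ?_
  simp [avg]

theorem differentiable_gradient_of_contDiff {φ : E → ℝ} (h : ContDiff ℝ 2 φ) :
    Differentiable ℝ (∇ φ) :=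
  (InnerProductSpace.toDual ℝ E).symm.differentiable.comp
    ((h.fderiv_right (m := 1) (by norm_num)).differentiable one_ne_zero)

theorem inner_fderiv_gradient_comm {φ : E → ℝ} (h : ContDiff ℝ 2 φ) (p u v : E) :
    inner ℝ (fderiv ℝ (∇ φ) p u) v = inner ℝ u (fderiv ℝ (∇ φ) p v) := by
  have hs := (h.contDiffAt (x := p)).isSymmSndFDerivAt (by simp)
  have h1 : HasFDerivAt (fderiv ℝ φ) (fderiv ℝ (fderiv ℝ φ) p) p :=
    ((h.fderiv_right (m := 1) (by norm_num)).differentiable one_ne_zero p).hasFDerivAt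
  have h2 : HasFDerivAt (∇ φ) ((InnerProductSpace.toDual ℝ E).symm.toContinuousLinearEquiv
      |>.toContinuousLinearMap.comp (fderiv ℝ (fderiv ℝ φ) p)) p :=
    (InnerProductSpace.toDual ℝ E).symm.toContinuousLinearEquiv.hasFDerivAt.comp p h1
  have e : ∀ u v, inner ℝ (fderiv ℝ (∇ φ) p u) v = fderiv ℝ (fderiv ℝ φ) p u v := fun u v => by
    rw [h2.fderiv]
    exact InnerProductSpace.toDual_symm_apply
  rw [e, real_inner_comm, e, hs.eq]

end General

/-! ### Joint and partial gradients -/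

section Joint

variable {n r : ℕ}

/-- The point `(x, y)` of `ℝ^n × ℝ^r` with the Euclidean norm. -/
abbrev pt (x : Vec n) (y : Vec r) : WithLp 2 (Vec n × Vec r) := WithLp.toLp 2 (x, y)

theorem norm_pt_sq (x : Vec n) (y : Vec r) : ‖pt x y‖ ^ 2 = ‖x‖ ^ 2 + ‖y‖ ^ 2 :=
  WithLp.prod_norm_sq_eq_of_L2 _

theorem pt_sub (x x' : Vec n) (y y' : Vec r) : pt x y - pt x' y' = pt (x - x') (y - y') := rfl

theorem norm_pt_zero_left (y : Vec r) : ‖pt (0 : Vec n) y‖ = ‖y‖ := by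
  have := norm_pt_sq (0 : Vec n) y
  rw [norm_zero, zero_pow two_ne_zero, zero_add] at this
  exact (pow_left_inj₀ (norm_nonneg _) (norm_nonneg _) two_ne_zero).1 this

theorem norm_pt_zero_right (x : Vec n) : ‖pt x (0 : Vec r)‖ = ‖x‖ := by
  have := norm_pt_sq x (0 : Vec r)
  rw [norm_zero, zero_pow two_ne_zero, add_zero] at this
  exact (pow_left_inj₀ (norm_nonneg _) (norm_nonneg _) two_ne_zero).1 this

theorem norm_fst_sq_le (u : WithLp 2 (Vec n × Vec r)) : ‖u.fst‖ ^ 2 ≤ ‖u‖ ^ 2 := by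
  rw [WithLp.prod_norm_sq_eq_of_L2]; exact le_add_of_nonneg_right (by positivity)

theorem norm_snd_sq_le (u : WithLp 2 (Vec n × Vec r)) : ‖u.snd‖ ^ 2 ≤ ‖u‖ ^ 2 := by
  rw [WithLp.prod_norm_sq_eq_of_L2]; exact le_add_of_nonneg_left (by positivity)

theorem norm_fst_le (u : WithLp 2 (Vec n × Vec r)) : ‖u.fst‖ ≤ ‖u‖ :=
  le_of_sq_le_sq (norm_fst_sq_le u) (norm_nonneg _)

theorem norm_snd_le (u : WithLp 2 (Vec n × Vec r)) : ‖u.snd‖ ≤ ‖u‖ :=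
  le_of_sq_le_sq (norm_snd_sq_le u) (norm_nonneg _)

variable {φ ψ : Vec n → Vec r → ℝ} {L : ℝ}

theorem hasGradientAt_fst {v : WithLp 2 (Vec n × Vec r)} {x : Vec n} {y : Vec r}
    (h : HasGradientAt (joint φ) v (pt x y)) : HasGradientAt (fun x' => φ x' y) v.fst x := by
  have hl : HasFDerivAt (fun x' : Vec n => pt x' y)
      ((WithLp.prodContinuousLinearEquiv 2 ℝ (Vec n) (Vec r)).symm.toContinuousLinearMap.comp
        (ContinuousLinearMap.inl ℝ (Vec n) (Vec r))) x :=
    (WithLp.prodContinuousLinearEquiv 2 ℝ (Vec n) (Vec r)).symm.hasFDerivAt.comp x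
      (hasFDerivAt_prodMk_left x y)
  rw [hasGradientAt_iff_hasFDerivAt]
  refine (h.hasFDerivAt.comp x hl).congr_fderiv ?_
  ext1 u
  simp [WithLp.prod_inner_apply]

theorem hasGradientAt_snd {v : WithLp 2 (Vec n × Vec r)} {x : Vec n} {y : Vec r}
    (h : HasGradientAt (joint φ) v (pt x y)) : HasGradientAt (fun y' => φ x y') v.snd y := by
  have hl : HasFDerivAt (fun y' : Vec r => pt x y')
      ((WithLp.prodContinuousLinearEquiv 2 ℝ (Vec n) (Vec r)).symm.toContinuousLinearMap.comp
        (ContinuousLinearMap.inr ℝ (Vec n) (Vec r))) y :=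
    (WithLp.prodContinuousLinearEquiv 2 ℝ (Vec n) (Vec r)).symm.hasFDerivAt.comp y
      (hasFDerivAt_prodMk_right x y)
  rw [hasGradientAt_iff_hasFDerivAt]
  refine (h.hasFDerivAt.comp y hl).congr_fderiv ?_
  ext1 u
  simp [WithLp.prod_inner_apply]

namespace IsSmooth

theorem hasGradientAt (h : IsSmooth L φ) (u : WithLp 2 (Vec n × Vec r)) :
    HasGradientAt (joint φ) (∇ (joint φ) u) u :=
  (h.1.differentiable one_ne_zero u).hasGradientAt

theorem gradX_eq (h : IsSmooth L φ) (x : Vec n) (y : Vec r) :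
    gradX φ x y = (∇ (joint φ) (pt x y)).fst :=
  (hasGradientAt_fst (h.hasGradientAt (pt x y))).gradient

theorem gradY_eq (h : IsSmooth L φ) (x : Vec n) (y : Vec r) :
    gradY φ x y = (∇ (joint φ) (pt x y)).snd :=
  (hasGradientAt_snd (h.hasGradientAt (pt x y))).gradient

theorem hasGradientAt_gradY (h : IsSmooth L φ) (x : Vec n) (y : Vec r) :
    HasGradientAt (φ x) (gradY φ x y) y := by
  rw [h.gradY_eq]; exact hasGradientAt_snd (h.hasGradientAt (pt x y))

theorem gradient_sub_sq_le (h : IsSmooth L φ) (x x' : Vec n) (y y' : Vec r) :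
    ‖∇ (joint φ) (pt x y) - ∇ (joint φ) (pt x' y')‖ ^ 2 ≤
      L ^ 2 * (‖x - x'‖ ^ 2 + ‖y - y'‖ ^ 2) := by
  rw [← norm_pt_sq, ← pt_sub, ← mul_pow]
  exact pow_le_pow_left₀ (norm_nonneg _) (h.2 _ _) 2

theorem gradX_sub_sq_le (h : IsSmooth L φ) (x x' : Vec n) (y y' : Vec r) :
    ‖gradX φ x y - gradX φ x' y'‖ ^ 2 ≤ L ^ 2 * (‖x - x'‖ ^ 2 + ‖y - y'‖ ^ 2) := by
  rw [h.gradX_eq, h.gradX_eq, ← WithLp.sub_fst]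
  exact (norm_fst_sq_le _).trans (h.gradient_sub_sq_le x x' y y')

theorem gradY_sub_sq_le (h : IsSmooth L φ) (x x' : Vec n) (y y' : Vec r) :
    ‖gradY φ x y - gradY φ x' y'‖ ^ 2 ≤ L ^ 2 * (‖x - x'‖ ^ 2 + ‖y - y'‖ ^ 2) := by
  rw [h.gradY_eq, h.gradY_eq, ← WithLp.sub_snd]
  exact (norm_snd_sq_le _).trans (h.gradient_sub_sq_le x x' y y')

theorem gradX_sub_le_right (h : IsSmooth L φ) (x : Vec n) (y y' : Vec r) :
    ‖gradX φ x y - gradX φ x y'‖ ≤ L * ‖y - y'‖ := by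
  rw [h.gradX_eq, h.gradX_eq, ← WithLp.sub_fst]
  refine (norm_fst_le _).trans ((h.2 _ _).trans (le_of_eq ?_))
  rw [pt_sub, sub_self, norm_pt_zero_left]

theorem gradY_sub_le_right (h : IsSmooth L φ) (x : Vec n) (y y' : Vec r) :
    ‖gradY φ x y - gradY φ x y'‖ ≤ L * ‖y - y'‖ := by
  rw [h.gradY_eq, h.gradY_eq, ← WithLp.sub_snd]
  refine (norm_snd_le _).trans ((h.2 _ _).trans (le_of_eq ?_))
  rw [pt_sub, sub_self, norm_pt_zero_left]

theorem gradY_sub_le_left (h : IsSmooth L φ) (x x' : Vec n) (y : Vec r) :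
    ‖gradY φ x y - gradY φ x' y‖ ≤ L * ‖x - x'‖ := by
  rw [h.gradY_eq, h.gradY_eq, ← WithLp.sub_snd]
  refine (norm_snd_le _).trans ((h.2 _ _).trans (le_of_eq ?_))
  rw [pt_sub, sub_self, norm_pt_zero_right]

theorem nonneg (hr : 1 ≤ r) (h : IsSmooth L φ) : 0 ≤ L := by
  have : Nonempty (Fin r) := ⟨⟨0, hr⟩⟩
  obtain ⟨v, hv⟩ := exists_ne (0 : Vec r)
  have h1 := (norm_nonneg _).trans (h.gradY_sub_le_right 0 v 0)
  rw [sub_zero] at h1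
  exact nonneg_of_mul_nonneg_left h1 (norm_pos_iff.2 hv)

end IsSmooth

namespace HasLipschitzHessian

theorem differentiable_gradient (h : HasLipschitzHessian L φ) :
    Differentiable ℝ (∇ (joint φ)) :=
  differentiable_gradient_of_contDiff h.1

theorem gradient_taylor (h : HasLipschitzHessian L φ) (p q : WithLp 2 (Vec n × Vec r)) :
    ‖∇ (joint φ) q - ∇ (joint φ) p - fderiv ℝ (∇ (joint φ)) p (q - p)‖ ≤
      L / 2 * ‖q - p‖ ^ 2 :=
  norm_taylor_le_of_lipschitz (fun x => (h.differentiable_gradient x).hasFDerivAt) h.2 p q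

theorem nonneg (hr : 1 ≤ r) (h : HasLipschitzHessian L φ) : 0 ≤ L := by
  have : Nonempty (Fin r) := ⟨⟨0, hr⟩⟩
  obtain ⟨v, hv⟩ := exists_ne (0 : Vec r)
  have h1 := (norm_nonneg _).trans (h.2 (pt 0 v) 0)
  rw [sub_zero, norm_pt_zero_left] at h1
  exact nonneg_of_mul_nonneg_left h1 (norm_pos_iff.2 hv)

end HasLipschitzHessian

end Joint

/-! ### Regularity of the averaged functions -/

section Mean

variable {m n r : ℕ} {h : Fin m → Vec n → Vec r → ℝ} {L : ℝ}

theorem joint_meanFun : joint (meanFun h) = fun u => avg fun i => joint (h i) u := rfl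

theorem contDiff_joint_meanFun {k : WithTop ℕ∞} (hh : ∀ i, ContDiff ℝ k (joint (h i))) :
    ContDiff ℝ k (joint (meanFun h)) := by
  rw [joint_meanFun]
  exact (ContDiff.sum fun i _ => hh i).const_smul (m : ℝ)⁻¹

theorem gradient_joint_meanFun (hh : ∀ i, ContDiff ℝ 1 (joint (h i)))
    (u : WithLp 2 (Vec n × Vec r)) :
    ∇ (joint (meanFun h)) u = avg fun i => ∇ (joint (h i)) u := by
  rw [joint_meanFun]
  exact (hasGradientAt_avg fun i =>
    ((hh i).differentiable one_ne_zero u).hasGradientAt).gradient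

variable [NeZero m]

theorem IsSmooth.mean (hh : ∀ i, IsSmooth L (h i)) : IsSmooth L (meanFun h) := by
  refine ⟨contDiff_joint_meanFun fun i => (hh i).1, fun u v => ?_⟩
  rw [gradient_joint_meanFun fun i => (hh i).1, gradient_joint_meanFun fun i => (hh i).1,
    ← avg_sub]
  refine (norm_avg_le _).trans ((avg_mono fun i => (hh i).2 u v).trans (le_of_eq ?_))
  exact avg_const _

theorem HasLipschitzHessian.mean (hh : ∀ i, HasLipschitzHessian L (h i)) :
    HasLipschitzHessian L (meanFun h) := by
  refine ⟨contDiff_joint_meanFun fun i => (hh i).1, fun u v => ?_⟩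
  have e : ∇ (joint (meanFun h)) = fun u => avg fun i => ∇ (joint (h i)) u :=
    funext fun u => gradient_joint_meanFun (fun i => (hh i).1.of_le (by norm_num)) u
  rw [e]
  exact norm_fderiv_avg_sub_le (fun i => (hh i).differentiable_gradient) fun i => (hh i).2 u v

theorem gradX_meanFun (hh : ∀ i, IsSmooth L (h i)) (x : Vec n) (y : Vec r) :
    gradX (meanFun h) x y = avg fun i => gradX (h i) x y := by
  rw [(IsSmooth.mean hh).gradX_eq, gradient_joint_meanFun fun i => (hh i).1]
  simp_rw [fun i => (hh i).gradX_eq]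
  exact map_avg (WithLp.fstL 2 ℝ (Vec n) (Vec r)).toLinearMap _

theorem gradY_meanFun (hh : ∀ i, IsSmooth L (h i)) (x : Vec n) (y : Vec r) :
    gradY (meanFun h) x y = avg fun i => gradY (h i) x y := by
  rw [(IsSmooth.mean hh).gradY_eq, gradient_joint_meanFun fun i => (hh i).1]
  simp_rw [fun i => (hh i).gradY_eq]
  exact map_avg (WithLp.sndL 2 ℝ (Vec n) (Vec r)).toLinearMap _

end Mean

end AHEAD

/-! ### Lower-level and penalized solution maps -/

namespace AHEAD

/-- Cauchy–Schwarz: the residual at b controls the distance to the zero a. All perturbation bounds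
for minimizers, and the invertibility of ∇²_yy g, come from this. -/
theorem norm_sub_le_of_strong_monotone {F : Type*} [NormedAddCommGroup F] [InnerProductSpace ℝ F]
    {A : F → F} {μ : ℝ} {a b : F} (h : μ * ‖a - b‖ ^ 2 ≤ inner ℝ (A a - A b) (a - b))
    (ha : A a = 0) : μ * ‖a - b‖ ≤ ‖A b‖ := by
  rcases eq_or_ne a b with rfl | hab
  · simp
  have h1 : 0 < ‖a - b‖ := norm_pos_iff.2 (sub_ne_zero.2 hab)
  have h2 := h.trans (real_inner_le_norm _ _)
  rw [ha, zero_sub, norm_neg, pow_two, ← mul_assoc] at h2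
  exact le_of_mul_le_mul_right h2 h1

/-- A bilevel problem with upper level `f` and lower level `g` that has the regularity
constants `c`. -/
structure IsBilevel {n r : ℕ} (f g : Vec n → Vec r → ℝ) (c : Constants) : Prop where
  f_smooth : IsSmooth c.Lf1 f
  g_smooth : IsSmooth c.Lg1 g
  hessian : HasLipschitzHessian c.Lg2 g
  μg_pos : 0 < c.μg
  mono : ∀ x y y', c.μg * ‖y - y'‖ ^ 2 ≤ inner ℝ (gradY g x y - gradY g x y') (y - y')
  bounded : ∀ x, ‖gradY f x (argmin (g x))‖ ≤ c.Cfy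
  Lf1_nonneg : 0 ≤ c.Lf1
  Lg2_nonneg : 0 ≤ c.Lg2
  μg_le : c.μg ≤ c.Lg1

/-- The minimizer of the penalized objective `f(x, ·) + lam (g(x, ·) - min g(x, ·))`. -/
noncomputable def penMin {n r : ℕ} (f g : Vec n → Vec r → ℝ) (lam : ℝ) (x : Vec n) : Vec r :=
  argmin fun y => f x y + lam * (g x y - g x (argmin (g x)))

/-- The gradient in `y` of the penalized objective. -/
noncomputable def penGrad {n r : ℕ} (f g : Vec n → Vec r → ℝ) (lam : ℝ) (x : Vec n) (y : Vec r) : Vec r :=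
  gradY f x y + lam • gradY g x y

/-- The gradient in `x` of the penalty approximation of the hyperobjective. -/
noncomputable def penHyperGrad {n r : ℕ} (f g : Vec n → Vec r → ℝ) (lam : ℝ) (x : Vec n) : Vec n :=
  gradX f x (penMin f g lam x) +
    lam • (gradX g x (penMin f g lam x) - gradX g x (argmin (g x)))

namespace IsBilevel

variable {n r : ℕ} {f g : Vec n → Vec r → ℝ} {c : Constants} {lam : ℝ}

theorem Lg1_pos (h : IsBilevel f g c) : 0 < c.Lg1 := h.μg_pos.trans_le h.μg_le

theorem one_le_LyStar (h : IsBilevel f g c) : 1 ≤ c.LyStar := by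
  rw [Constants.LyStar, one_le_div h.μg_pos]; exact h.μg_le

theorem Lg1_eq (h : IsBilevel f g c) : c.Lg1 = c.LyStar * c.μg := by
  rw [Constants.LyStar, div_mul_cancel₀ _ h.μg_pos.ne']

theorem Cfy_nonneg (h : IsBilevel f g c) : 0 ≤ c.Cfy := (norm_nonneg _).trans (h.bounded 0)

theorem lam_pos (h : IsBilevel f g c) (hl : 2 * c.Lf1 / c.μg < lam) : 0 < lam :=
  (div_nonneg (mul_nonneg two_pos.le h.Lf1_nonneg) h.μg_pos.le).trans_lt hl

theorem Lf1_lt (h : IsBilevel f g c) (hl : 2 * c.Lf1 / c.μg < lam) :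
    c.Lf1 < lam * c.μg / 2 := by
  rw [div_lt_iff₀ h.μg_pos] at hl; linarith

theorem gradY_argmin (h : IsBilevel f g c) (x : Vec n) : gradY g x (argmin (g x)) = 0 :=
  gradient_argmin (fun y => h.g_smooth.hasGradientAt_gradY x y) h.μg_pos (h.mono x)

theorem norm_argmin_sub_le (h : IsBilevel f g c) (x x' : Vec n) :
    ‖argmin (g x') - argmin (g x)‖ ≤ c.LyStar * ‖x' - x‖ := by
  have h1 := norm_sub_le_of_strong_monotone (h.mono x' (argmin (g x')) (argmin (g x)))
    (h.gradY_argmin x')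
  have h2 := h.g_smooth.gradY_sub_le_left x' x (argmin (g x))
  rw [h.gradY_argmin x, sub_zero] at h2
  rw [Constants.LyStar, div_mul_eq_mul_div, le_div_iff₀ h.μg_pos, mul_comm]
  exact h1.trans h2

theorem hasGradientAt_penGrad (h : IsBilevel f g c) (x : Vec n) (b : ℝ) (y : Vec r) :
    HasGradientAt (fun y => f x y + lam * (g x y - b)) (penGrad f g lam x y) y := by
  rw [hasGradientAt_iff_hasFDerivAt, penGrad, map_add, map_smulₛₗ]
  exact (h.f_smooth.hasGradientAt_gradY x y).hasFDerivAt.add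
    (((h.g_smooth.hasGradientAt_gradY x y).hasFDerivAt.sub_const b).const_mul lam)

theorem penGrad_sub_le_right (h : IsBilevel f g c) (hl : 0 ≤ lam) (x : Vec n) (y y' : Vec r) :
    ‖penGrad f g lam x y - penGrad f g lam x y'‖ ≤ c.Llam lam * ‖y - y'‖ := by
  have e : penGrad f g lam x y - penGrad f g lam x y' = (gradY f x y - gradY f x y') +
    lam • (gradY g x y - gradY g x y') := by simp only [penGrad]; module
  rw [e, Constants.Llam, add_mul, mul_assoc]
  refine (norm_add_le _ _).trans (add_le_add (h.f_smooth.gradY_sub_le_right _ _ _) ?_)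
  rw [norm_smul, Real.norm_of_nonneg hl]
  exact mul_le_mul_of_nonneg_left (h.g_smooth.gradY_sub_le_right _ _ _) hl

theorem penGrad_sub_le_left (h : IsBilevel f g c) (hl : 0 ≤ lam) (x x' : Vec n) (y : Vec r) :
    ‖penGrad f g lam x y - penGrad f g lam x' y‖ ≤ c.Llam lam * ‖x - x'‖ := by
  have e : penGrad f g lam x y - penGrad f g lam x' y = (gradY f x y - gradY f x' y) +
    lam • (gradY g x y - gradY g x' y) := by simp only [penGrad]; module
  rw [e, Constants.Llam, add_mul, mul_assoc]
  refine (norm_add_le _ _).trans (add_le_add (h.f_smooth.gradY_sub_le_left _ _ _) ?_)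
  rw [norm_smul, Real.norm_of_nonneg hl]
  exact mul_le_mul_of_nonneg_left (h.g_smooth.gradY_sub_le_left _ _ _) hl

/-- The possible nonconvexity of f costs at most L_{f,1} < λμ_g/2, which is half of the modulus λμ_g
that λg provides. -/
theorem penGrad_mono (h : IsBilevel f g c) (hl : 2 * c.Lf1 / c.μg < lam) (x : Vec n)
    (y y' : Vec r) : c.μlam lam * ‖y - y'‖ ^ 2 ≤
      inner ℝ (penGrad f g lam x y - penGrad f g lam x y') (y - y') := by
  have e : penGrad f g lam x y - penGrad f g lam x y' = (gradY f x y - gradY f x y') +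
    lam • (gradY g x y - gradY g x y') := by simp only [penGrad]; module
  rw [e, inner_add_left, inner_smul_left, Constants.μlam]
  have h1 := mul_le_mul_of_nonneg_left (h.mono x y y') (h.lam_pos hl).le
  have h2 := (neg_le_abs _).trans (abs_real_inner_le_norm (gradY f x y - gradY f x y') (y - y'))
  have h3 := mul_le_mul_of_nonneg_right (h.f_smooth.gradY_sub_le_right x y y')
    (norm_nonneg (y - y'))
  have h4 := mul_le_mul_of_nonneg_right (h.Lf1_lt hl).le (sq_nonneg ‖y - y'‖)
  simp only [RCLike.conj_to_real]
  linarith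

theorem μlam_pos (h : IsBilevel f g c) (hl : 2 * c.Lf1 / c.μg < lam) : 0 < c.μlam lam := by
  have := mul_pos (h.lam_pos hl) h.μg_pos
  rw [Constants.μlam]; positivity

theorem penGrad_penMin (h : IsBilevel f g c) (hl : 2 * c.Lf1 / c.μg < lam) (x : Vec n) :
    penGrad f g lam x (penMin f g lam x) = 0 :=
  gradient_argmin (fun y => h.hasGradientAt_penGrad x _ y) (h.μlam_pos hl) (h.penGrad_mono hl x)

theorem Llam_le (h : IsBilevel f g c) (hl : 2 * c.Lf1 / c.μg < lam) :
    c.Llam lam ≤ 3 / 2 * (lam * c.Lg1) := by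
  have h1 := h.Lf1_lt hl
  have h2 := mul_le_mul_of_nonneg_left h.μg_le (h.lam_pos hl).le
  rw [Constants.Llam]; linarith

/-- The Lipschitz constant is L_λ/μ_λ; since L_λ ≤ (3/2)λL_{g,1}, it is at most 3κ, uniformly in λ.
-/
theorem norm_penMin_sub_le (h : IsBilevel f g c) (hl : 2 * c.Lf1 / c.μg < lam) (x x' : Vec n) :
    ‖penMin f g lam x' - penMin f g lam x‖ ≤ 3 * c.LyStar * ‖x' - x‖ := by
  have h1 := norm_sub_le_of_strong_monotone
    (h.penGrad_mono hl x' (penMin f g lam x') (penMin f g lam x)) (h.penGrad_penMin hl x')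
  have h2 := h.penGrad_sub_le_left (h.lam_pos hl).le x' x (penMin f g lam x)
  rw [h.penGrad_penMin hl x, sub_zero] at h2
  have h3 := mul_le_mul_of_nonneg_right (h.Llam_le hl) (norm_nonneg (x' - x))
  refine le_of_mul_le_mul_left ?_ (h.μlam_pos hl)
  refine (h1.trans (h2.trans h3)).trans (le_of_eq ?_)
  rw [Constants.μlam, h.Lg1_eq]; ring

/-- At y*(x) the penalized gradient reduces to ∇_y f, a residual of at most C_{f,y} against the
modulus λμ_g/2. -/
theorem norm_penMin_sub_argmin_le (h : IsBilevel f g c) (hl : 2 * c.Lf1 / c.μg < lam)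
    (x : Vec n) : ‖penMin f g lam x - argmin (g x)‖ ≤ c.Cin / lam := by
  have h1 := norm_sub_le_of_strong_monotone
    (h.penGrad_mono hl x (penMin f g lam x) (argmin (g x))) (h.penGrad_penMin hl x)
  rw [penGrad, h.gradY_argmin, smul_zero, add_zero] at h1
  have h2 := h1.trans (h.bounded x)
  have := h.lam_pos hl
  have := h.μg_pos
  rw [Constants.μlam] at h2
  rw [Constants.Cin, div_div, le_div_iff₀ (by positivity)]
  linarith

theorem norm_hessian_le (h : IsBilevel f g c) (p : WithLp 2 (Vec n × Vec r)) :
    ‖fderiv ℝ (∇ (joint g)) p‖ ≤ c.Lg1 := by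
  have hL : LipschitzWith (Real.toNNReal c.Lg1) (∇ (joint g)) :=
    LipschitzWith.of_dist_le_mul fun u v => by
      rw [dist_eq_norm, dist_eq_norm, Real.coe_toNNReal _ h.Lg1_pos.le]; exact h.g_smooth.2 u v
  simpa [Real.coe_toNNReal _ h.Lg1_pos.le] using norm_fderiv_le_of_lipschitz ℝ hL (x₀ := p)

/-- Strong monotonicity between y + tv and y, divided by t², holds for the Hessian up to a Taylor
error O(t). -/
theorem hessian_coercive (h : IsBilevel f g c) (x : Vec n) (y v : Vec r) :
    c.μg * ‖v‖ ^ 2 ≤ inner ℝ (fderiv ℝ (∇ (joint g)) (pt x y) (pt 0 v)).snd v := by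
  set T := fderiv ℝ (∇ (joint g)) (pt x y) with hT
  have key : ∀ t : ℝ, 0 < t →
      c.μg * ‖v‖ ^ 2 ≤ inner ℝ (T (pt 0 v)).snd v + t * (c.Lg2 / 2 * ‖v‖ ^ 2 * ‖v‖) :=
    fun t ht => by
      have h1 := h.mono x (y + t • v) y
      have h2 := h.hessian.gradient_taylor (pt x y) (pt x (y + t • v))
      have e1 : pt x (y + t • v) - pt x y = t • pt (0 : Vec n) v := by
        rw [pt_sub, sub_self, add_sub_cancel_left]
        change _ = pt (t • (0 : Vec n)) (t • v)
        rw [smul_zero]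
      rw [e1, map_smul, ← hT, norm_smul, Real.norm_of_nonneg ht.le, norm_pt_zero_left] at h2
      set e := ∇ (joint g) (pt x (y + t • v)) - ∇ (joint g) (pt x y) - t • T (pt 0 v) with he
      have e2 : gradY g x (y + t • v) - gradY g x y = e.snd + t • (T (pt 0 v)).snd := by
        rw [h.g_smooth.gradY_eq, h.g_smooth.gradY_eq, he]; simp
      rw [add_sub_cancel_left, e2, norm_smul, Real.norm_of_nonneg ht.le, inner_smul_right,
        inner_add_left, inner_smul_left, RCLike.conj_to_real] at h1
      have h3 := (real_inner_le_norm e.snd v).trans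
        (mul_le_mul_of_nonneg_right ((norm_snd_le e).trans h2) (norm_nonneg v))
      have h4 := mul_le_mul_of_nonneg_left h3 ht.le
      refine le_of_mul_le_mul_left (a := t ^ 2) ?_ (by positivity)
      nlinarith
  refine le_of_forall_pos_le_add fun ε hε => ?_
  set b := c.Lg2 / 2 * ‖v‖ ^ 2 * ‖v‖ with hb
  have hb0 : 0 ≤ b := by have := h.Lg2_nonneg; positivity
  -- The denominator is b + 1 because b may vanish.
  refine (key (ε / (b + 1)) (by positivity)).trans ?_
  gcongr
  rw [div_mul_eq_mul_div, div_le_iff₀ (by positivity)]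
  nlinarith

/-- The derivative of the lower-level solution map, with a quantitative error bound. -/
theorem exists_sensitivity (h : IsBilevel f g c) (x : Vec n) :
    ∃ D : Vec n →L[ℝ] Vec r, (∀ u, ‖D u‖ ≤ c.LyStar * ‖u‖) ∧
      (∀ u, (fderiv ℝ (∇ (joint g)) (pt x (argmin (g x))) (pt u (D u))).snd = 0) ∧
      ∀ x', ‖argmin (g x') - argmin (g x) - D (x' - x)‖ ≤
        c.Lg2 * (1 + c.LyStar ^ 2) / (2 * c.μg) * ‖x' - x‖ ^ 2 := by
  set y := argmin (g x) with hy
  set T := fderiv ℝ (∇ (joint g)) (pt x y) with hT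
  let S := WithLp.sndL 2 ℝ (Vec n) (Vec r)
  let J := (WithLp.prodContinuousLinearEquiv 2 ℝ (Vec n) (Vec r)).symm.toContinuousLinearMap
  let H : Vec r →ₗ[ℝ] Vec r := (S ∘L T ∘L J ∘L ContinuousLinearMap.inr ℝ (Vec n) (Vec r)).toLinearMap
  let M : Vec n →ₗ[ℝ] Vec r := (S ∘L T ∘L J ∘L ContinuousLinearMap.inl ℝ (Vec n) (Vec r)).toLinearMap
  have hH : ∀ v, H v = (T (pt 0 v)).snd := fun v => rfl
  have hM : ∀ u, M u = (T (pt u 0)).snd := fun u => rfl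
  have hsplit : ∀ u v, (T (pt u v)).snd = M u + H v := fun u v => by
    have e : pt u v = pt u 0 + pt 0 v := by
      rw [← WithLp.toLp_add, Prod.mk_add_mk, add_zero, zero_add]
    rw [hH, hM, e, map_add, WithLp.add_snd]
  have hco : ∀ v, c.μg * ‖v‖ ≤ ‖H v‖ := fun v => by
    have := norm_sub_le_of_strong_monotone (A := H) (μ := c.μg) (a := 0) (b := v) (by
      have := h.hessian_coercive x y v
      rw [← hT, ← hH] at this
      simpa using this) (map_zero _)
    simpa using this
  have hinj : Function.Injective H := (injective_iff_map_eq_zero H).2 fun v hv => by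
    have h1 := hco v
    rw [hv, norm_zero] at h1
    exact norm_le_zero_iff.1 (nonpos_of_mul_nonpos_right h1 h.μg_pos)
  let E := LinearEquiv.ofInjectiveEndo H hinj
  have hE : ∀ v, H (E.symm v) = v := fun v => E.apply_symm_apply v
  -- D = −H⁻¹M, with H = ∇²_yy g invertible because it is injective on a finite-dimensional space.
  -- This makes (u, Du) tangent to the set where ∇_y g vanishes.
  let D : Vec n →ₗ[ℝ] Vec r := -(E.symm.toLinearMap ∘ₗ M)
  have hD : ∀ u, H (D u) = -M u := fun u => by
    change H (-(E.symm (M u))) = _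
    rw [map_neg, hE]
  have hμ := h.μg_pos
  refine ⟨LinearMap.toContinuousLinearMap D, fun u => ?_, fun u => ?_, fun x' => ?_⟩
  · have h1 := hco (D u)
    have h2 : ‖M u‖ ≤ c.Lg1 * ‖u‖ := by
      rw [hM]
      refine (norm_snd_le _).trans ((T.le_opNorm _).trans ?_)
      rw [norm_pt_zero_right]
      exact mul_le_mul_of_nonneg_right (h.norm_hessian_le _) (norm_nonneg _)
    rw [hD, norm_neg] at h1
    change ‖D u‖ ≤ _
    rw [Constants.LyStar, div_mul_eq_mul_div, le_div_iff₀ hμ]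
    linarith
  · change (T (pt u (D u))).snd = 0
    rw [hsplit, hD, add_neg_cancel]
  · change ‖argmin (g x') - y - D (x' - x)‖ ≤ _
    set d := argmin (g x') - y with hd
    -- Both endpoints satisfy ∇_y g = 0, so in the y-component of the expansion of ∇g only the
    -- linear term H(d − D(x' − x)) and the remainder survive.
    have h1 := h.hessian.gradient_taylor (pt x y) (pt x' (argmin (g x')))
    rw [pt_sub x' x, ← hd, ← hT, norm_pt_sq] at h1
    have h2 := (norm_snd_le _).trans h1
    rw [WithLp.sub_snd, WithLp.sub_snd, ← h.g_smooth.gradY_eq, ← h.g_smooth.gradY_eq,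
      h.gradY_argmin, hy, h.gradY_argmin, sub_zero, zero_sub, norm_neg, hsplit] at h2
    have e : M (x' - x) + H d = H (d - D (x' - x)) := by
      rw [map_sub H d (D (x' - x)), hD]; abel
    rw [e] at h2
    have h3 := pow_le_pow_left₀ (norm_nonneg _) (h.norm_argmin_sub_le x x') 2
    rw [← hy, ← hd] at h3
    have h4 : c.Lg2 / 2 * (‖x' - x‖ ^ 2 + ‖d‖ ^ 2) ≤
        c.Lg2 / 2 * (‖x' - x‖ ^ 2 + (c.LyStar * ‖x' - x‖) ^ 2) := by
      have := h.Lg2_nonneg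
      gcongr
    have h5 := (hco _).trans (h2.trans h4)
    rw [div_mul_eq_mul_div, le_div_iff₀ (by positivity)]
    linarith

/-! ### The hypergradient and the bias of the penalty -/

section Hypergradient

variable {x : Vec n} {D : Vec n →L[ℝ] Vec r}

/-- Second-order expansion of the hyperobjective, with the remainder of the lower-level solution
map kept explicit. -/
theorem abs_hyperobjective_sub_le (h : IsBilevel f g c) (x' : Vec n) :
    |f x' (argmin (g x')) - f x (argmin (g x)) -
        inner ℝ (gradX f x (argmin (g x)) + D.adjoint (gradY f x (argmin (g x)))) (x' - x)| ≤
      c.Lf1 * (1 + c.LyStar ^ 2) / 2 * ‖x' - x‖ ^ 2 +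
        c.Cfy * ‖argmin (g x') - argmin (g x) - D (x' - x)‖ := by
  set y := argmin (g x) with hy
  set d := argmin (g x') - y with hd
  have h1 := abs_taylor_le_of_lipschitz_gradient h.f_smooth.hasGradientAt h.f_smooth.2 (pt x y)
    (pt x' (argmin (g x')))
  rw [pt_sub, ← hd, norm_pt_sq, WithLp.prod_inner_apply] at h1
  change |f x' (argmin (g x')) - f x y - (inner ℝ (∇ (joint f) (pt x y)).fst (x' - x) +
    inner ℝ (∇ (joint f) (pt x y)).snd d)| ≤ _ at h1
  rw [← h.f_smooth.gradX_eq, ← h.f_smooth.gradY_eq] at h1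
  have h2 := abs_real_inner_le_norm (gradY f x y) (d - D (x' - x))
  have h3 := mul_le_mul_of_nonneg_right (h.bounded x) (norm_nonneg (d - D (x' - x)))
  have h4 := pow_le_pow_left₀ (norm_nonneg _) (h.norm_argmin_sub_le x x') 2
  rw [← hy, ← hd] at h4
  have h5 : c.Lf1 / 2 * (‖x' - x‖ ^ 2 + ‖d‖ ^ 2) ≤
      c.Lf1 / 2 * (‖x' - x‖ ^ 2 + (c.LyStar * ‖x' - x‖) ^ 2) := by
    have := h.Lf1_nonneg
    gcongr
  rw [inner_add_left, ContinuousLinearMap.adjoint_inner_left]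
  rw [inner_sub_right] at h2
  rw [← hy] at h3
  have h6 := abs_add_le (f x' (argmin (g x')) - f x y -
    (inner ℝ (gradX f x y) (x' - x) + inner ℝ (gradY f x y) d))
    (inner ℝ (gradY f x y) d - inner ℝ (gradY f x y) (D (x' - x)))
  have e : f x' (argmin (g x')) - f x y - (inner ℝ (gradX f x y) (x' - x) +
      inner ℝ (gradY f x y) (D (x' - x))) = (f x' (argmin (g x')) - f x y -
    (inner ℝ (gradX f x y) (x' - x) + inner ℝ (gradY f x y) d)) +
    (inner ℝ (gradY f x y) d - inner ℝ (gradY f x y) (D (x' - x))) := by ring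
  rw [e]
  linarith

theorem hasGradientAt_hyperobjective (h : IsBilevel f g c)
    (hD : ∀ x', ‖argmin (g x') - argmin (g x) - D (x' - x)‖ ≤
      c.Lg2 * (1 + c.LyStar ^ 2) / (2 * c.μg) * ‖x' - x‖ ^ 2) :
    HasGradientAt (fun x => f x (argmin (g x)))
      (gradX f x (argmin (g x)) + D.adjoint (gradY f x (argmin (g x)))) x := by
  rw [hasGradientAt_iff_isLittleO]
  refine Asymptotics.IsBigO.trans_isLittleO (g := fun x' => ‖x' - x‖ ^ 2) ?_ ?_
  · refine Asymptotics.IsBigO.of_bound (c.Lf1 * (1 + c.LyStar ^ 2) / 2 +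
      c.Cfy * (c.Lg2 * (1 + c.LyStar ^ 2) / (2 * c.μg))) (Filter.Eventually.of_forall fun x' => ?_)
    rw [Real.norm_eq_abs, Real.norm_of_nonneg (sq_nonneg ‖x' - x‖)]
    refine (h.abs_hyperobjective_sub_le x').trans ?_
    have := mul_le_mul_of_nonneg_left (hD x') h.Cfy_nonneg
    linarith
  · exact Asymptotics.isLittleO_pow_sub_sub x one_lt_two

/-- The bias of the penalty gradient. -/
theorem norm_penHyperGrad_sub_le (h : IsBilevel f g c) (hl : 2 * c.Lf1 / c.μg < lam)
    (hD₁ : ∀ u, ‖D u‖ ≤ c.LyStar * ‖u‖)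
    (hD₂ : ∀ u, (fderiv ℝ (∇ (joint g)) (pt x (argmin (g x))) (pt u (D u))).snd = 0) :
    ‖penHyperGrad f g lam x -
      (gradX f x (argmin (g x)) + D.adjoint (gradY f x (argmin (g x))))‖ ≤ c.Cou / lam := by
  have hl0 := h.lam_pos hl
  have hk := h.one_le_LyStar
  set y := argmin (g x) with hy
  set z := penMin f g lam x with hz
  set δ := c.Cin / lam with hδ
  have hzy : ‖z - y‖ ≤ δ := h.norm_penMin_sub_argmin_le hl x
  have hδ0 : 0 ≤ δ := (norm_nonneg _).trans hzy
  set w := penHyperGrad f g lam x - (gradX f x y + D.adjoint (gradY f x y)) with hw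
  set T := fderiv ℝ (∇ (joint g)) (pt x y) with hT
  have e0 : pt x z - pt x y = pt 0 (z - y) := by rw [pt_sub, sub_self]
  have hF := h.f_smooth.2 (pt x z) (pt x y)
  have hG := h.hessian.gradient_taylor (pt x y) (pt x z)
  rw [e0, norm_pt_zero_left] at hF hG
  rw [← hT] at hG
  set eF := ∇ (joint f) (pt x z) - ∇ (joint f) (pt x y) with heF
  set eG := ∇ (joint g) (pt x z) - ∇ (joint g) (pt x y) - T (pt 0 (z - y)) with heG
  have hz0 : gradY f x z + lam • gradY g x z = 0 := h.penGrad_penMin hl x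
  -- By symmetry the Hessian moves onto (w, Dw), where its y-component vanishes, while (0, z − y)
  -- has no x-component.
  have hT0 : inner ℝ (T (pt 0 (z - y))) (pt w (D w)) = 0 := by
    rw [inner_fderiv_gradient_comm h.hessian.1, WithLp.prod_inner_apply]
    change inner ℝ (0 : Vec n) _ + inner ℝ (z - y) (T (pt w (D w))).snd = 0
    rw [hD₂, inner_zero_left, inner_zero_right, add_zero]
  -- Stationarity of z for the penalized objective adds ⟨∇_y f + λ∇_y g, Dw⟩ = 0, completing the
  -- x-gradients to joint gradients tested against (w, Dw). By `hT0`, λ then multiplies only the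
  -- second-order remainder eG.
  have key : inner ℝ w w = inner ℝ eF (pt w (D w)) + lam * inner ℝ eG (pt w (D w)) := by
    have h1 : inner ℝ eG (pt w (D w)) =
        inner ℝ (∇ (joint g) (pt x z) - ∇ (joint g) (pt x y)) (pt w (D w)) := by
      rw [heG, inner_sub_left _ (T _), hT0, sub_zero]
    rw [h1, WithLp.prod_inner_apply, WithLp.prod_inner_apply]
    change _ = inner ℝ eF.fst w + inner ℝ eF.snd (D w) +
      lam * (inner ℝ (∇ (joint g) (pt x z) - ∇ (joint g) (pt x y)).fst w +
        inner ℝ (∇ (joint g) (pt x z) - ∇ (joint g) (pt x y)).snd (D w))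
    rw [heF]
    simp only [WithLp.sub_fst, WithLp.sub_snd]
    rw [← h.f_smooth.gradX_eq, ← h.f_smooth.gradY_eq, ← h.g_smooth.gradX_eq,
      ← h.g_smooth.gradY_eq, ← h.f_smooth.gradX_eq, ← h.f_smooth.gradY_eq, ← h.g_smooth.gradX_eq,
      ← h.g_smooth.gradY_eq]
    have h2 : inner ℝ w w = inner ℝ (penHyperGrad f g lam x) w - inner ℝ (gradX f x y) w -
        inner ℝ (gradY f x y) (D w) := by
      conv_lhs => rw [hw]
      rw [inner_sub_left, inner_add_left, ContinuousLinearMap.adjoint_inner_left]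
      ring
    have h3 : inner ℝ (gradY f x z) (D w) + lam * inner ℝ (gradY g x z) (D w) = 0 := by
      have := congrArg (fun q => inner ℝ q (D w)) hz0
      simpa [inner_add_left, inner_smul_left] using this
    have h4 : gradY g x y = 0 := h.gradY_argmin x
    have h5 : inner ℝ (penHyperGrad f g lam x) w = inner ℝ (gradX f x z) w +
        lam * (inner ℝ (gradX g x z) w - inner ℝ (gradX g x y) w) := by
      rw [penHyperGrad, inner_add_left, inner_smul_left, RCLike.conj_to_real, inner_sub_left]
    rw [h2, h5, h4]
    simp only [inner_sub_left, inner_zero_left]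
    linarith
  have hpt : ‖pt w (D w)‖ ≤ (1 + c.LyStar) * ‖w‖ := by
    refine le_of_sq_le_sq ?_ (by positivity)
    rw [norm_pt_sq]
    have := pow_le_pow_left₀ (norm_nonneg _) (hD₁ w) 2
    nlinarith [mul_nonneg (zero_le_one.trans hk) (sq_nonneg ‖w‖)]
  have b1 := (real_inner_le_norm eF (pt w (D w))).trans
    (mul_le_mul (hF.trans (mul_le_mul_of_nonneg_left hzy h.Lf1_nonneg)) hpt (norm_nonneg _)
      (mul_nonneg h.Lf1_nonneg hδ0))
  have hδ2 : c.Lg2 / 2 * ‖z - y‖ ^ 2 ≤ c.Lg2 / 2 * δ ^ 2 := by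
    have := h.Lg2_nonneg
    gcongr
  have b2 := (real_inner_le_norm eG (pt w (D w))).trans
    (mul_le_mul (hG.trans hδ2) hpt (norm_nonneg _)
      (by have := h.Lg2_nonneg; positivity))
  have b3 := mul_le_mul_of_nonneg_left b2 hl0.le
  rw [real_inner_self_eq_norm_sq] at key
  have e1 : c.Cou / lam = (c.Lf1 * δ + lam * (c.Lg2 / 2 * δ ^ 2)) * (1 + c.LyStar) := by
    rw [hδ, Constants.Cou, Constants.LyStar]; field_simp
  have h6 : ‖w‖ * ‖w‖ ≤ ‖w‖ * (c.Cou / lam) := by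
    rw [e1]; nlinarith
  rcases eq_or_lt_of_le (norm_nonneg w) with h7 | h7
  · rw [← h7, e1]
    have := h.Lg2_nonneg
    have := h.Lf1_nonneg
    positivity
  · exact le_of_mul_le_mul_left h6 h7

/-- A bound of the bias of the penalty gradient that does not use the Hessian. -/
theorem norm_penHyperGrad_sub_le' (h : IsBilevel f g c) (hl : 2 * c.Lf1 / c.μg < lam)
    (hD₁ : ∀ u, ‖D u‖ ≤ c.LyStar * ‖u‖) :
    ‖penHyperGrad f g lam x -
      (gradX f x (argmin (g x)) + D.adjoint (gradY f x (argmin (g x))))‖ ≤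
      4 * c.LyStar * c.Cfy := by
  have hl0 := h.lam_pos hl
  have hk := h.one_le_LyStar
  have hμ := h.μg_pos
  have hC := h.Cfy_nonneg
  set y := argmin (g x) with hy
  set z := penMin f g lam x with hz
  have hzy : ‖z - y‖ ≤ c.Cin / lam := h.norm_penMin_sub_argmin_le hl x
  have e : penHyperGrad f g lam x - (gradX f x y + D.adjoint (gradY f x y)) =
      (gradX f x z - gradX f x y) + lam • (gradX g x z - gradX g x y)
        - D.adjoint (gradY f x y) := by
    rw [penHyperGrad]; abel
  have h1 := (h.f_smooth.gradX_sub_le_right x z y).trans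
    (mul_le_mul (h.Lf1_lt hl).le hzy (norm_nonneg _) (by positivity))
  have h2 := mul_le_mul_of_nonneg_left ((h.g_smooth.gradX_sub_le_right x z y).trans
    (mul_le_mul_of_nonneg_left hzy h.Lg1_pos.le)) hl0.le
  have h3 : ‖D.adjoint (gradY f x y)‖ ≤ c.LyStar * c.Cfy := by
    refine (D.adjoint.le_opNorm _).trans ?_
    rw [LinearIsometryEquiv.norm_map]
    exact mul_le_mul (D.opNorm_le_bound (by positivity) hD₁) (h.bounded x) (norm_nonneg _)
      (by positivity)
  rw [e]
  refine (norm_sub_le _ _).trans ((add_le_add_left (norm_add_le _ _) _).trans ?_)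
  rw [norm_smul, Real.norm_of_nonneg hl0.le]
  have e1 : lam * c.μg / 2 * (c.Cin / lam) = c.Cfy := by
    rw [Constants.Cin]; field_simp
  have e2 : lam * (c.Lg1 * (c.Cin / lam)) = 2 * c.LyStar * c.Cfy := by
    rw [Constants.Cin, Constants.LyStar]; field_simp
  rw [e1] at h1
  rw [e2] at h2
  nlinarith

end Hypergradient

end IsBilevel

end AHEAD

/-! ### Descent of the hyperobjective and tracking of the minimizers -/

namespace AHEAD

theorem norm_add_sq_le_two {E : Type*} [NormedAddCommGroup E] [InnerProductSpace ℝ E] (a b : E) :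
    ‖a + b‖ ^ 2 ≤ 2 * ‖a‖ ^ 2 + 2 * ‖b‖ ^ 2 := by
  have := norm_add_sq_le_weighted one_pos a b
  norm_num at this
  exact this

theorem norm_sub_sq_le_two {E : Type*} [NormedAddCommGroup E] [InnerProductSpace ℝ E] (a b : E) :
    ‖a - b‖ ^ 2 ≤ 2 * ‖a‖ ^ 2 + 2 * ‖b‖ ^ 2 := by
  have := norm_add_sq_le_two a (-b)
  rwa [norm_neg, ← sub_eq_add_neg] at this

theorem norm_add_sq_le_three {E : Type*} [NormedAddCommGroup E] [InnerProductSpace ℝ E]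
    (a b c : E) : ‖a + b + c‖ ^ 2 ≤ 3 * ‖a‖ ^ 2 + 3 * ‖b‖ ^ 2 + 3 * ‖c‖ ^ 2 := by
  have h1 := norm_add_sq_le_weighted two_pos (b + c) a
  have h2 := norm_add_sq_le_two b c
  have h3 := norm_add_sq_le_weighted (show (0 : ℝ) < 1 / 2 by norm_num) (b + c) a
  have e : b + c + a = a + b + c := by abel
  rw [e] at h3
  norm_num at h3
  linarith

/-- A perturbed contraction. -/
theorem norm_add_add_sq_le_of_contraction {E : Type*} [NormedAddCommGroup E]
    [InnerProductSpace ℝ E] {u v w : E} {q d b e : ℝ} (hq : 0 < q) (hq' : q ≤ 1 / 32)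
    (hd : 0 ≤ d) (hu : ‖u‖ ^ 2 ≤ (1 - 15 / 4 * q) * d) (hv : ‖v‖ ^ 2 ≤ b) (hw : ‖w‖ ^ 2 ≤ e) :
    ‖u + v + w‖ ^ 2 ≤ (1 - q) * d + 6 / 5 / q * b + 3 / 5 / q * e := by
  -- The weight 11/4·q spends part of the contraction: (1 + 11/4·q)(1 − 15/4·q) ≤ 1 − q. The other
  -- factor is (q + 4/11)/q, at most (2/5)/q because q ≤ 1/32.
  have h1 := norm_add_sq_le_weighted (show 0 < 11 / 4 * q by positivity) u (v + w)
  have h2 := norm_add_sq_le_weighted (show (0 : ℝ) < 2 by norm_num) v w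
  rw [← add_assoc] at h1
  have hb : 0 ≤ b := (sq_nonneg _).trans hv
  have he : 0 ≤ e := (sq_nonneg _).trans hw
  have h3 : (1 + 11 / 4 * q) * ‖u‖ ^ 2 ≤ (1 - q) * d := by
    have := mul_le_mul_of_nonneg_left hu (show 0 ≤ 1 + 11 / 4 * q by positivity)
    nlinarith [mul_nonneg (sq_nonneg q) hd]
  have h4 : (1 + (11 / 4 * q)⁻¹) ≤ 2 / 5 / q := by
    rw [le_div_iff₀ hq]
    have : (1 + (11 / 4 * q)⁻¹) * q = q + 4 / 11 := by field_simp
    rw [this]; linarith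
  have h5 : ‖v + w‖ ^ 2 ≤ 3 * b + 3 / 2 * e := by norm_num at h2; linarith
  have h6 : (1 + (11 / 4 * q)⁻¹) * ‖v + w‖ ^ 2 ≤ 2 / 5 / q * (3 * b + 3 / 2 * e) :=
    mul_le_mul h4 h5 (sq_nonneg _) (by positivity)
  have h7 : 2 / 5 / q * (3 * b + 3 / 2 * e) = 6 / 5 / q * b + 3 / 5 / q * e := by ring
  linarith

namespace IsBilevel

variable {n r : ℕ} {f g : Vec n → Vec r → ℝ} {c : Constants} {lam : ℝ}

theorem differentiable_hyperobjective (h : IsBilevel f g c) :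
    Differentiable ℝ fun x => f x (argmin (g x)) := fun x => by
  obtain ⟨D, -, -, hD⟩ := h.exists_sensitivity x
  exact (h.hasGradientAt_hyperobjective hD).differentiableAt

/-- If the curvature of the lower-level solution map is large compared with the inverse of the
step size, then the penalty error is large. -/
theorem le_Cou_div_of_curvature (h : IsBilevel f g c) (hl : 2 * c.Lf1 / c.μg < lam) {α : ℝ}
    (hα : 0 < α) (hα' : α * (c.LyStar * c.Lg1 * lam) ≤ 1 / 512)
    (hB : 1 / 8 < α * (c.Cfy * c.Lg2 * (1 + c.LyStar ^ 2) / c.μg)) :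
    5 * (c.LyStar * c.Cfy) ≤ c.Cou / lam := by
  have hl0 := h.lam_pos hl
  have hk := h.one_le_LyStar
  have hμ := h.μg_pos
  have hC := h.Cfy_nonneg
  have hL2 := h.Lg2_nonneg
  have hLf := h.Lf1_nonneg
  have hLg := h.Lg1_eq
  set κ := c.LyStar with hκ
  -- Eliminates α: `hα'` with L_{g,1} = κμ_g reads ακ²μ_gλ ≤ 1/512, and 1/8 = 64/512.
  have h3 : 64 * (κ ^ 2 * c.μg ^ 2 * lam) ≤ c.Cfy * c.Lg2 * (1 + κ ^ 2) := by
    have e : α * (c.Cfy * c.Lg2 * (1 + κ ^ 2) / c.μg) * c.μg =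
      α * (c.Cfy * c.Lg2 * (1 + κ ^ 2)) := by field_simp
    have h4 := mul_lt_mul_of_pos_right hB hμ
    rw [e] at h4
    have h6 := mul_le_mul_of_nonneg_right hα' hμ.le
    rw [hLg] at h6
    refine (le_of_mul_le_mul_left ?_ hα)
    linarith
  have h4 : c.Cin * (1 + κ) * (c.Lg2 * c.Cin / 2) / lam ≤ c.Cou / lam := by
    have hCin : 0 ≤ c.Cin := by rw [Constants.Cin]; positivity
    rw [Constants.Cou, ← Constants.LyStar, ← hκ]
    gcongr
    exact le_add_of_nonneg_left hLf
  refine le_trans ?_ h4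
  rw [Constants.Cin, le_div_iff₀ hl0]
  have e : 2 * c.Cfy / c.μg * (1 + κ) * (c.Lg2 * (2 * c.Cfy / c.μg) / 2) =
    2 * c.Cfy * (1 + κ) * (c.Cfy * c.Lg2) / c.μg ^ 2 := by field_simp
  rw [e, le_div_iff₀ (by positivity)]
  refine le_of_mul_le_mul_right ?_ (show 0 < 1 + κ ^ 2 by positivity)
  have h6 := mul_le_mul_of_nonneg_left h3 (show 0 ≤ 2 * c.Cfy * (1 + κ) by positivity)
  have h7 : 5 * (κ * (1 + κ ^ 2)) ≤ 128 * ((1 + κ) * κ ^ 2) := by nlinarith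
  have h8 := mul_le_mul_of_nonneg_right h7 (show 0 ≤ c.Cfy * c.μg ^ 2 * lam by positivity)
  linarith

/-- Descent of the hyperobjective along an inexact gradient step. If the curvature of the
lower-level solution map is too large for the step size, then the penalty error dominates. -/
theorem hyperobjective_descent (h : IsBilevel f g c) (hl : 2 * c.Lf1 / c.μg < lam) {α : ℝ}
    (hα : 0 < α) (hα' : α * (c.LyStar * c.Lg1 * lam) ≤ 1 / 512) (x d : Vec n) :
    2 * (f (x - α • d) (argmin (g (x - α • d))) - f x (argmin (g x))) ≤
      α * (-‖∇ (fun x => f x (argmin (g x))) x‖ ^ 2 - 1 / 2 * ‖d‖ ^ 2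
        + 2 * c.Cou ^ 2 / lam ^ 2 + 2 * ‖penHyperGrad f g lam x - d‖ ^ 2) := by
  obtain ⟨D, hD₁, hD₂, hD⟩ := h.exists_sensitivity x
  rw [(h.hasGradientAt_hyperobjective hD).gradient]
  have hl0 := h.lam_pos hl
  have hk := h.one_le_LyStar
  have hμ := h.μg_pos
  have hC := h.Cfy_nonneg
  have hL2 := h.Lg2_nonneg
  have hLf := h.Lf1_nonneg
  have hLg := h.Lg1_eq
  set κ := c.LyStar with hκ
  set G := gradX f x (argmin (g x)) + D.adjoint (gradY f x (argmin (g x))) with hG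
  set p := penHyperGrad f g lam x with hp
  have h1 := (le_abs_self _).trans (h.abs_hyperobjective_sub_le (D := D) (x := x) (x - α • d))
  have hR2 := hD (x - α • d)
  have hR1 : ‖argmin (g (x - α • d)) - argmin (g x) - D (x - α • d - x)‖ ≤
      2 * κ * (α * ‖d‖) := by
    have h2 := h.norm_argmin_sub_le x (x - α • d)
    have h3 := hD₁ (x - α • d - x)
    have h4 := norm_sub_le (argmin (g (x - α • d)) - argmin (g x)) (D (x - α • d - x))
    rw [sub_sub_cancel_left, norm_neg, norm_smul, Real.norm_of_nonneg hα.le] at h2 h3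
    rw [sub_sub_cancel_left] at h4 ⊢
    linarith
  rw [← hG, ← hκ] at h1
  set R := ‖argmin (g (x - α • d)) - argmin (g x) - D (x - α • d - x)‖
  rw [sub_sub_cancel_left, norm_neg, norm_smul, Real.norm_of_nonneg hα.le] at h1 hR2
  rw [inner_neg_right, inner_smul_right] at h1
  -- L_{f,1} < λμ_g/2 and 1 + κ² ≤ 2κ² reduce the left side to ακL_{g,1}λ.
  have hb : c.Lf1 * (1 + κ ^ 2) * α ≤ 1 / 512 := by
    have h2 := mul_le_mul (h.Lf1_lt hl).le (show 1 + κ ^ 2 ≤ 2 * κ ^ 2 by nlinarith)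
      (by positivity) (by positivity)
    have h3 := mul_le_mul_of_nonneg_right h2 hα.le
    refine h3.trans (le_trans (le_of_eq ?_) hα')
    rw [hLg]; ring
  have hGd : 2 * inner ℝ G d = ‖G‖ ^ 2 + ‖d‖ ^ 2 - ‖G - d‖ ^ 2 := by
    rw [norm_sub_sq_real]; ring
  have hGd2 : ‖G - d‖ ^ 2 ≤ 2 * ‖p - G‖ ^ 2 + 2 * ‖p - d‖ ^ 2 := by
    have e : G - d = (p - d) - (p - G) := by abel
    rw [e]
    linarith [norm_sub_sq_le_two (p - d) (p - G)]
  have hsmooth : c.Lf1 * (1 + κ ^ 2) * (α * ‖d‖) ^ 2 ≤ α * (1 / 512 * ‖d‖ ^ 2) := by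
    have := mul_le_mul_of_nonneg_right hb (show 0 ≤ α * ‖d‖ ^ 2 by positivity)
    linarith
  have hstep : 2 * (f (x - α • d) (argmin (g (x - α • d))) - f x (argmin (g x))) ≤
      α * (-‖G‖ ^ 2 - ‖d‖ ^ 2 + 2 * ‖p - G‖ ^ 2 + 2 * ‖p - d‖ ^ 2 + 1 / 512 * ‖d‖ ^ 2)
        + 2 * (c.Cfy * R) := by
    have := mul_le_mul_of_nonneg_left hGd2 hα.le
    have h2 : α * (2 * inner ℝ G d) = α * (‖G‖ ^ 2 + ‖d‖ ^ 2 - ‖G - d‖ ^ 2) := by rw [hGd]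
    linarith
  -- Small curvature: the quadratic bound on R costs ‖d‖²/8, within the slack. Large curvature: the
  -- linear bound on R and the Hessian-free bias bound cost (16 + 2·4²)(κC_{f,y})² = 48(κC_{f,y})²,
  -- covered by 2(C_ou/λ)² ≥ 50(κC_{f,y})².
  rcases le_or_gt (α * (c.Cfy * c.Lg2 * (1 + κ ^ 2) / c.μg)) (1 / 8) with hB | hB
  · have h2 : 2 * (c.Cfy * R) ≤ α * (1 / 8 * ‖d‖ ^ 2) := by
      have h3 := mul_le_mul_of_nonneg_left hR2 hC
      have h4 := mul_le_mul_of_nonneg_right hB (show 0 ≤ α * ‖d‖ ^ 2 by positivity)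
      have e : α * (c.Cfy * c.Lg2 * (1 + κ ^ 2) / c.μg) * (α * ‖d‖ ^ 2) =
        2 * (c.Cfy * (c.Lg2 * (1 + κ ^ 2) / (2 * c.μg) * (α * ‖d‖) ^ 2)) := by
        field_simp
      linarith
    have h5 := pow_le_pow_left₀ (norm_nonneg _) (h.norm_penHyperGrad_sub_le hl hD₁ hD₂) 2
    rw [← hG, ← hp, div_pow] at h5
    have h6 : -‖G‖ ^ 2 - ‖d‖ ^ 2 + 2 * ‖p - G‖ ^ 2 + 2 * ‖p - d‖ ^ 2 + 1 / 512 * ‖d‖ ^ 2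
        + 1 / 8 * ‖d‖ ^ 2 ≤ -‖G‖ ^ 2 - 1 / 2 * ‖d‖ ^ 2
        + 2 * c.Cou ^ 2 / lam ^ 2 + 2 * ‖p - d‖ ^ 2 := by
      rw [mul_div_assoc]
      linarith [sq_nonneg ‖d‖]
    have h7 := mul_le_mul_of_nonneg_left h6 hα.le
    linarith
  · have h5 := pow_le_pow_left₀ (norm_nonneg _) (h.norm_penHyperGrad_sub_le' (x := x) hl hD₁) 2
    rw [← hG, ← hp, ← hκ] at h5
    have h2 : 2 * (c.Cfy * R) ≤ α * (1 / 4 * ‖d‖ ^ 2 + 16 * (κ * c.Cfy) ^ 2) := by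
      have h3 := mul_le_mul_of_nonneg_left hR1 hC
      have h4 := mul_nonneg hα.le (sq_nonneg (1 / 2 * ‖d‖ - 4 * (κ * c.Cfy)))
      linarith
    have hCou := h.le_Cou_div_of_curvature hl hα hα' hB
    have h8 := pow_le_pow_left₀ (by positivity) hCou 2
    rw [div_pow] at h8
    have h6 : -‖G‖ ^ 2 - ‖d‖ ^ 2 + 2 * ‖p - G‖ ^ 2 + 2 * ‖p - d‖ ^ 2 + 1 / 512 * ‖d‖ ^ 2
        + (1 / 4 * ‖d‖ ^ 2 + 16 * (κ * c.Cfy) ^ 2) ≤ -‖G‖ ^ 2 - 1 / 2 * ‖d‖ ^ 2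
        + 2 * c.Cou ^ 2 / lam ^ 2 + 2 * ‖p - d‖ ^ 2 := by
      rw [mul_div_assoc]
      linarith [sq_nonneg ‖d‖, sq_nonneg (κ * c.Cfy)]
    have h7 := mul_le_mul_of_nonneg_left h6 hα.le
    linarith

/-- Recursion of the distance to the lower-level solution. -/
theorem lower_tracking (h : IsBilevel f g c) {γ w : ℝ} (hγ : 0 < γ) (hγL : γ * c.Lg1 ≤ 1 / 16)
    (hw : 0 < w) (hwμ : w ≤ c.μg / 2) {α b : ℝ} (x d : Vec n) (z e : Vec r)
    (he : ‖e - gradY g x z‖ ^ 2 ≤ b) :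
    ‖z - γ • e - argmin (g (x - α • d))‖ ^ 2 ≤
      (1 - w * γ) * ‖z - argmin (g x)‖ ^ 2 + 6 / 5 / (w * γ) * (γ ^ 2 * b)
        + 3 / 5 / (w * γ) * (c.LyStar ^ 2 * (α ^ 2 * ‖d‖ ^ 2)) := by
  have hwγ : w * γ ≤ γ * c.μg / 2 := by nlinarith
  have hγμ : γ * c.μg ≤ 1 / 16 := (mul_le_mul_of_nonneg_left h.μg_le hγ.le).trans hγL
  have hgd := norm_gradient_step_sq_le (fun y => h.g_smooth.hasGradientAt_gradY x y) h.Lg1_pos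
    h.μg_pos.le (h.g_smooth.gradY_sub_le_right x) (h.mono x) hγ.le (by linarith) z (argmin (g x))
  rw [h.gradY_argmin, smul_zero, sub_zero] at hgd
  -- Exact gradient step towards the old minimizer, error of the direction, drift of the minimizer.
  have e1 : z - γ • e - argmin (g (x - α • d)) = (z - γ • gradY g x z - argmin (g x)) +
    (-γ) • (e - gradY g x z) + (argmin (g x) - argmin (g (x - α • d))) := by module
  rw [e1]
  refine norm_add_add_sq_le_of_contraction (by positivity) (by linarith) (sq_nonneg _)
    (hgd.trans (mul_le_mul_of_nonneg_right ?_ (sq_nonneg _))) ?_ ?_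
  · have := mul_le_mul_of_nonneg_right (show 15 / 8 ≤ 2 - γ * c.Lg1 by linarith)
      (mul_pos hγ h.μg_pos).le
    linarith
  · rw [norm_smul, mul_pow, norm_neg, Real.norm_of_nonneg hγ.le]
    gcongr
  · have := pow_le_pow_left₀ (norm_nonneg _) (h.norm_argmin_sub_le (x - α • d) x) 2
    rwa [mul_pow, sub_sub_cancel, norm_smul, mul_pow, Real.norm_eq_abs, sq_abs] at this

/-- Recursion of the distance to the solution of the penalized problem. -/
theorem penalty_tracking (h : IsBilevel f g c) (hl : 2 * c.Lf1 / c.μg < lam) {β w : ℝ}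
    (hβ : 0 < β) (hβL : β * c.Llam lam ≤ 1 / 16)
    (hw : 0 < w) (hwμ : w ≤ c.μlam lam / 2) {α b : ℝ} (x d : Vec n) (y e : Vec r)
    (he : ‖e - penGrad f g lam x y‖ ^ 2 ≤ b) :
    ‖y - β • e - penMin f g lam (x - α • d)‖ ^ 2 ≤
      (1 - w * β) * ‖y - penMin f g lam x‖ ^ 2 + 6 / 5 / (w * β) * (β ^ 2 * b)
        + 3 / 5 / (w * β) * (9 * c.LyStar ^ 2 * (α ^ 2 * ‖d‖ ^ 2)) := by
  have hl0 := h.lam_pos hl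
  have hμL : c.μlam lam ≤ c.Llam lam := by
    have := mul_le_mul_of_nonneg_left h.μg_le hl0.le
    have := mul_pos hl0 h.μg_pos
    rw [Constants.μlam, Constants.Llam]; linarith [h.Lf1_nonneg]
  have hwβ : w * β ≤ β * c.μlam lam / 2 := by nlinarith
  have hβμ : β * c.μlam lam ≤ 1 / 16 := (mul_le_mul_of_nonneg_left hμL hβ.le).trans hβL
  have hgd := norm_gradient_step_sq_le (fun y => h.hasGradientAt_penGrad x 0 y)
    ((h.μlam_pos hl).trans_le hμL) (h.μlam_pos hl).le (h.penGrad_sub_le_right hl0.le x)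
    (h.penGrad_mono hl x) hβ.le (by linarith) y (penMin f g lam x)
  rw [h.penGrad_penMin hl, smul_zero, sub_zero] at hgd
  have e1 : y - β • e - penMin f g lam (x - α • d) =
    (y - β • penGrad f g lam x y - penMin f g lam x) +
    (-β) • (e - penGrad f g lam x y) + (penMin f g lam x - penMin f g lam (x - α • d)) := by module
  rw [e1]
  refine norm_add_add_sq_le_of_contraction (by positivity) (by linarith) (sq_nonneg _)
    (hgd.trans (mul_le_mul_of_nonneg_right ?_ (sq_nonneg _))) ?_ ?_
  · have := mul_le_mul_of_nonneg_right (show 15 / 8 ≤ 2 - β * c.Llam lam by linarith)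
      (mul_pos hβ (h.μlam_pos hl)).le
    linarith
  · rw [norm_smul, mul_pow, norm_neg, Real.norm_of_nonneg hβ.le]
    gcongr
  · have := pow_le_pow_left₀ (norm_nonneg _) (h.norm_penMin_sub_le hl (x - α • d) x) 2
    rw [mul_pow, sub_sub_cancel, norm_smul, mul_pow, mul_pow, Real.norm_eq_abs, sq_abs] at this
    linarith

end IsBilevel

end AHEAD

/-! ### Errors of the averaged and local directions -/

namespace AHEAD

theorem IsSmooth.gradY_sub_le {n r : ℕ} {φ : Vec n → Vec r → ℝ} {L : ℝ} (h : IsSmooth L φ)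
    (x x' : Vec n) (y y' : Vec r) :
    ‖gradY φ x y - gradY φ x' y'‖ ≤ L * ‖pt x y - pt x' y'‖ := by
  rw [h.gradY_eq, h.gradY_eq, ← WithLp.sub_snd]
  exact (norm_snd_le _).trans (h.2 _ _)

theorem avg_norm_sub_sq_eq {m d : ℕ} [NeZero m] (v : Fin m → Vec d) (a : Vec d) :
    avg (fun i => ‖v i - a‖ ^ 2) = consensusError v + ‖avg v - a‖ ^ 2 :=
  avg_norm_sub_sq v a

/-- Bias–variance applied to the differences, so that the factor 2 falls on the consensus errors and
not on the means. -/
theorem avg_norm_sub_sq_le {m d : ℕ} [NeZero m] (v w : Fin m → Vec d) :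
    avg (fun i => ‖v i - w i‖ ^ 2) ≤
      2 * consensusError v + 2 * consensusError w + ‖avg v - avg w‖ ^ 2 := by
  have h := avg_norm_sub_sq (fun i => v i - w i) 0
  simp only [sub_zero, avg_sub] at h
  rw [h, consensusError, consensusError, ← avg_mul, ← avg_mul, ← avg_add]
  gcongr
  refine avg_mono fun i => ?_
  rw [sub_sub_sub_comm]
  exact norm_sub_sq_le_two _ _

section Estimates

variable {m n r : ℕ} {P : Problem m n r} {c : Constants} {lam : ℝ}

theorem yStarPen_eq (lam : ℝ) (x : Vec n) :
    P.yStarPen lam x = penMin (meanFun P.f) (meanFun P.g) lam x := by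
  rw [Problem.yStarPen, penMin]
  congr 1
  funext y
  rw [Problem.penalty, avg_add, avg_mul, avg_sub]
  rfl

theorem norm_pt_sub_sq (x x' : Vec n) (y y' : Vec r) :
    ‖pt x y - pt x' y'‖ ^ 2 = ‖x - x'‖ ^ 2 + ‖y - y'‖ ^ 2 := by
  rw [pt_sub, norm_pt_sq]

theorem norm_local_penGrad_sub_sq_le (ho : OuterAssumption P c) (hi : InnerAssumption P c)
    (hl : 0 ≤ lam) (i : Fin m) (x x' : Vec n) (y y' : Vec r) :
    ‖penGrad (P.f i) (P.g i) lam x y - penGrad (P.f i) (P.g i) lam x' y'‖ ^ 2 ≤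
      c.Llam lam ^ 2 * (‖x - x'‖ ^ 2 + ‖y - y'‖ ^ 2) := by
  have e : penGrad (P.f i) (P.g i) lam x y - penGrad (P.f i) (P.g i) lam x' y' =
    (gradY (P.f i) x y - gradY (P.f i) x' y') +
      lam • (gradY (P.g i) x y - gradY (P.g i) x' y') := by simp only [penGrad]; module
  rw [e, ← norm_pt_sub_sq, ← mul_pow]
  refine pow_le_pow_left₀ (norm_nonneg _) ?_ 2
  rw [Constants.Llam, add_mul, mul_assoc]
  refine (norm_add_le _ _).trans (add_le_add ((ho.smooth i).gradY_sub_le _ _ _ _) ?_)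
  rw [norm_smul, Real.norm_of_nonneg hl]
  exact mul_le_mul_of_nonneg_left ((hi.smooth i).gradY_sub_le _ _ _ _) hl

/-- Distance of the average `y` to the lower-level solution. -/
theorem norm_avg_y_sub_yStar_sq_le (h : IsBilevel (meanFun P.f) (meanFun P.g) c)
    (hl : 2 * c.Lf1 / c.μg < lam) (y : Vec r) (x : Vec n) :
    ‖y - P.yStar x‖ ^ 2 ≤ 2 * ‖y - P.yStarPen lam x‖ ^ 2 + 2 * (c.Cin / lam) ^ 2 := by
  have h1 := pow_le_pow_left₀ (norm_nonneg _) (h.norm_penMin_sub_argmin_le hl x) 2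
  rw [← yStarPen_eq] at h1
  have h2 := norm_add_sq_le_two (y - P.yStarPen lam x) (P.yStarPen lam x - P.yStar x)
  rw [sub_add_sub_cancel] at h2
  exact h2.trans (add_le_add le_rfl (mul_le_mul_of_nonneg_left h1 two_pos.le))

theorem norm_sub_sq_le_of_yStar (h : IsBilevel (meanFun P.f) (meanFun P.g) c)
    (hl : 2 * c.Lf1 / c.μg < lam) (y z : Vec r) (x : Vec n) :
    ‖y - z‖ ^ 2 ≤ 3 * ‖y - P.yStarPen lam x‖ ^ 2 + 3 * ‖z - P.yStar x‖ ^ 2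
      + 3 * (c.Cin / lam) ^ 2 := by
  have h1 := pow_le_pow_left₀ (norm_nonneg _) (h.norm_penMin_sub_argmin_le hl x) 2
  rw [← yStarPen_eq] at h1
  have h2 := norm_add_sq_le_three (y - P.yStarPen lam x) (P.yStarPen lam x - P.yStar x)
    (P.yStar x - z)
  rw [sub_add_sub_cancel, sub_add_sub_cancel, norm_sub_rev (P.yStar x) z] at h2
  change ‖P.yStarPen lam x - P.yStar x‖ ^ 2 ≤ _ at h1
  linarith

variable [NeZero m]

/-- Averaging preserves all the bounds. A nonzero vector, available as r ≥ 1, gives the signs of the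
Lipschitz constants and μ_g ≤ L_{g,1}. -/
theorem isBilevel (hr : 1 ≤ r) (ho : OuterAssumption P c) (hi : InnerAssumption P c) :
    IsBilevel (meanFun P.f) (meanFun P.g) c := by
  have hmono : ∀ x y y', c.μg * ‖y - y'‖ ^ 2 ≤
      inner ℝ (gradY (meanFun P.g) x y - gradY (meanFun P.g) x y') (y - y') := fun x y y' => by
    rw [gradY_meanFun hi.smooth, gradY_meanFun hi.smooth, ← avg_sub, real_inner_comm]
    have h1 := map_avg (innerₛₗ ℝ (y - y'))
      (fun i => gradY (P.g i) x y - gradY (P.g i) x y')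
    simp only [innerₛₗ_apply_apply] at h1
    rw [h1, ← avg_const (m := m) (c.μg * ‖y - y'‖ ^ 2)]
    refine avg_mono fun i => ?_
    rw [real_inner_comm]
    exact StrongConvexOn.strong_monotone (fun y => (hi.smooth i).hasGradientAt_gradY x y)
      (hi.strongConvex i x) y y'
  have hg := IsSmooth.mean hi.smooth
  refine ⟨IsSmooth.mean ho.smooth, hg, HasLipschitzHessian.mean hi.hessian, hi.μg_pos, hmono,
    fun x => ?_, (ho.smooth 0).nonneg hr, (hi.hessian 0).nonneg hr, ?_⟩
  · rw [gradY_meanFun ho.smooth]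
    exact (norm_avg_le _).trans ((avg_mono fun i => ho.bounded i x).trans (avg_const _).le)
  · have : Nonempty (Fin r) := ⟨⟨0, hr⟩⟩
    obtain ⟨v, hv⟩ := exists_ne (0 : Vec r)
    have h1 := (hmono 0 v 0).trans (real_inner_le_norm _ _)
    have h2 := mul_le_mul_of_nonneg_right (hg.gradY_sub_le_right 0 v 0) (norm_nonneg (v - 0))
    have h3 := h1.trans h2
    rw [sub_zero, mul_assoc, ← pow_two] at h3
    exact le_of_mul_le_mul_right h3 (by have := norm_pos_iff.2 hv; positivity)

variable (s : State m n r)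

theorem norm_avg_hx_sub_sq_le (ho : OuterAssumption P c) (hi : InnerAssumption P c) :
    ‖penHyperGrad (meanFun P.f) (meanFun P.g) lam (avg s.x) - avg (hx P lam s)‖ ^ 2 ≤
      3 * c.Usq lam * (consensusError s.x + consensusError s.y
        + ‖avg s.y - P.yStarPen lam (avg s.x)‖ ^ 2)
      + 3 * (lam ^ 2 * c.Lg1 ^ 2) * (consensusError s.x + consensusError s.z
        + ‖avg s.z - P.yStar (avg s.x)‖ ^ 2) := by
  rw [yStarPen_eq]
  set X := avg s.x with hX
  set p := penMin (meanFun P.f) (meanFun P.g) lam X with hp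
  set q := P.yStar X with hq
  have e : penHyperGrad (meanFun P.f) (meanFun P.g) lam X - avg (hx P lam s) =
      -avg fun i => (gradX (P.f i) (s.x i) (s.y i) - gradX (P.f i) X p)
        + lam • (gradX (P.g i) (s.x i) (s.y i) - gradX (P.g i) X p)
        + (-lam) • (gradX (P.g i) (s.x i) (s.z i) - gradX (P.g i) X q) := by
    have e1 : ∀ i, (gradX (P.f i) (s.x i) (s.y i) - gradX (P.f i) X p)
        + lam • (gradX (P.g i) (s.x i) (s.y i) - gradX (P.g i) X p)
        + (-lam) • (gradX (P.g i) (s.x i) (s.z i) - gradX (P.g i) X q) =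
        hx P lam s i - (gradX (P.f i) X p + lam • (gradX (P.g i) X p - gradX (P.g i) X q)) :=
      fun i => by rw [hx]; module
    simp_rw [e1]
    rw [avg_sub, neg_sub, avg_add, avg_smul, avg_sub, ← gradX_meanFun ho.smooth,
      ← gradX_meanFun hi.smooth, ← gradX_meanFun hi.smooth]
    rfl
  rw [e, norm_neg]
  refine (norm_avg_sq_le _).trans ?_
  have key : ∀ i, ‖(gradX (P.f i) (s.x i) (s.y i) - gradX (P.f i) X p)
        + lam • (gradX (P.g i) (s.x i) (s.y i) - gradX (P.g i) X p)
        + (-lam) • (gradX (P.g i) (s.x i) (s.z i) - gradX (P.g i) X q)‖ ^ 2 ≤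
      3 * c.Usq lam * (‖s.x i - X‖ ^ 2 + ‖s.y i - p‖ ^ 2)
        + 3 * (lam ^ 2 * c.Lg1 ^ 2) * (‖s.x i - X‖ ^ 2 + ‖s.z i - q‖ ^ 2) := fun i => by
    refine (norm_add_sq_le_three _ _ _).trans ?_
    rw [norm_smul, norm_smul, norm_neg, mul_pow, mul_pow, Real.norm_eq_abs, sq_abs]
    have h1 := (ho.smooth i).gradX_sub_sq_le (s.x i) X (s.y i) p
    have h2 := mul_le_mul_of_nonneg_left
      ((hi.smooth i).gradX_sub_sq_le (s.x i) X (s.y i) p) (sq_nonneg lam)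
    have h3 := mul_le_mul_of_nonneg_left
      ((hi.smooth i).gradX_sub_sq_le (s.x i) X (s.z i) q) (sq_nonneg lam)
    rw [Constants.Usq]
    linarith
  refine (avg_mono key).trans (le_of_eq ?_)
  rw [avg_add, avg_mul, avg_mul, avg_add, avg_add, avg_norm_sub_sq_eq, avg_norm_sub_sq_eq,
    avg_norm_sub_sq_eq, ← hX, sub_self, norm_zero]
  ring

theorem penGrad_meanFun (ho : OuterAssumption P c) (hi : InnerAssumption P c) (x : Vec n)
    (y : Vec r) : penGrad (meanFun P.f) (meanFun P.g) lam x y =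
      avg fun i => penGrad (P.f i) (P.g i) lam x y := by
  simp only [penGrad]
  rw [avg_add, avg_smul, gradY_meanFun ho.smooth, gradY_meanFun hi.smooth]

theorem norm_avg_hy_sub_sq_le (ho : OuterAssumption P c) (hi : InnerAssumption P c)
    (hl : 0 ≤ lam) :
    ‖avg (hy P lam s) - penGrad (meanFun P.f) (meanFun P.g) lam (avg s.x) (avg s.y)‖ ^ 2 ≤
      c.Llam lam ^ 2 * (consensusError s.x + consensusError s.y) := by
  rw [penGrad_meanFun ho hi, ← avg_sub]
  refine (norm_avg_sq_le _).trans ?_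
  refine (avg_mono fun i => norm_local_penGrad_sub_sq_le ho hi hl i _ _ _ _).trans (le_of_eq ?_)
  rw [avg_mul, avg_add]
  rfl

theorem norm_avg_hz_sub_sq_le (hi : InnerAssumption P c) :
    ‖avg (hz P s) - gradY (meanFun P.g) (avg s.x) (avg s.z)‖ ^ 2 ≤
      c.Lg1 ^ 2 * (consensusError s.x + consensusError s.z) := by
  rw [gradY_meanFun hi.smooth, ← avg_sub]
  refine (norm_avg_sq_le _).trans ?_
  refine (avg_mono fun i => (hi.smooth i).gradY_sub_sq_le _ _ _ _).trans (le_of_eq ?_)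
  rw [avg_mul, avg_add]
  rfl

/-- The λ-part is a difference of gradients of the same g_i at the same x_i, bounded by ‖y_i − z_i‖.
Hence only b_f enters the x-direction, and b_g does not. -/
theorem avg_hx_sub_sq_le (hr : 1 ≤ r) (ho : OuterAssumption P c) (hi : InnerAssumption P c)
    (hh : HeterogeneityAssumption P c) (hl : 2 * c.Lf1 / c.μg < lam) :
    avg (fun i => ‖hx P lam s i - gradX (meanFun P.f) (avg s.x) (P.yStar (avg s.x))‖ ^ 2) ≤
      3 * c.bf ^ 2
      + 3 * c.Lf1 ^ 2 * (consensusError s.x + consensusError s.y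
        + 2 * ‖avg s.y - P.yStarPen lam (avg s.x)‖ ^ 2 + 2 * (c.Cin / lam) ^ 2)
      + 3 * (lam ^ 2 * c.Lg1 ^ 2) * (2 * consensusError s.y + 2 * consensusError s.z
        + 3 * ‖avg s.y - P.yStarPen lam (avg s.x)‖ ^ 2 + 3 * ‖avg s.z - P.yStar (avg s.x)‖ ^ 2
        + 3 * (c.Cin / lam) ^ 2) := by
  have h := isBilevel hr ho hi
  set X := avg s.x with hX
  set q := P.yStar X with hq
  have key : ∀ i, ‖hx P lam s i - gradX (meanFun P.f) X q‖ ^ 2 ≤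
      3 * ‖gradX (P.f i) X q - gradX (meanFun P.f) X q‖ ^ 2
        + (3 * c.Lf1 ^ 2 * (‖s.x i - X‖ ^ 2 + ‖s.y i - q‖ ^ 2)
        + 3 * (lam ^ 2 * c.Lg1 ^ 2) * ‖s.y i - s.z i‖ ^ 2) := fun i => by
    have e : hx P lam s i - gradX (meanFun P.f) X q =
        (gradX (P.f i) X q - gradX (meanFun P.f) X q) +
        ((gradX (P.f i) (s.x i) (s.y i) - gradX (P.f i) X q) +
          lam • (gradX (P.g i) (s.x i) (s.y i) - gradX (P.g i) (s.x i) (s.z i))) := by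
      rw [hx]; abel
    have h1 := norm_add_sq_le_weighted two_pos (gradX (P.f i) X q - gradX (meanFun P.f) X q)
      ((gradX (P.f i) (s.x i) (s.y i) - gradX (P.f i) X q) +
          lam • (gradX (P.g i) (s.x i) (s.y i) - gradX (P.g i) (s.x i) (s.z i)))
    rw [← e] at h1
    have h2 := norm_add_sq_le_two (gradX (P.f i) (s.x i) (s.y i) - gradX (P.f i) X q)
      (lam • (gradX (P.g i) (s.x i) (s.y i) - gradX (P.g i) (s.x i) (s.z i)))
    have h3 := (ho.smooth i).gradX_sub_sq_le (s.x i) X (s.y i) q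
    have h4 := mul_le_mul_of_nonneg_left
      ((hi.smooth i).gradX_sub_sq_le (s.x i) (s.x i) (s.y i) (s.z i)) (sq_nonneg lam)
    rw [sub_self, norm_zero] at h4
    rw [norm_smul, mul_pow, Real.norm_eq_abs, sq_abs] at h2
    norm_num at h1
    linarith
  refine (avg_mono key).trans ?_
  rw [avg_add, avg_add, avg_mul, avg_mul, avg_mul, avg_add, avg_norm_sub_sq_eq s.x,
    avg_norm_sub_sq_eq s.y, ← hX, sub_self, norm_zero]
  have h1 : avg (fun i => ‖gradX (P.f i) X q - gradX (meanFun P.f) X q‖ ^ 2) ≤ c.bf ^ 2 := hh.fx X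
  have h2 := norm_avg_y_sub_yStar_sq_le h hl (avg s.y) X
  have h3 := (avg_norm_sub_sq_le s.y s.z).trans
    (add_le_add le_rfl (norm_sub_sq_le_of_yStar h hl (avg s.y) (avg s.z) X))
  rw [← hq] at h2 h3
  have h4 := mul_le_mul_of_nonneg_left h2 (show 0 ≤ 3 * c.Lf1 ^ 2 by positivity)
  have h5 := mul_le_mul_of_nonneg_left h3 (show 0 ≤ 3 * (lam ^ 2 * c.Lg1 ^ 2) by positivity)
  linarith

theorem avg_hy_sub_sq_le (hr : 1 ≤ r) (ho : OuterAssumption P c) (hi : InnerAssumption P c)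
    (hh : HeterogeneityAssumption P c) (hl : 2 * c.Lf1 / c.μg < lam) :
    avg (fun i => ‖hy P lam s i -
      penGrad (meanFun P.f) (meanFun P.g) lam (avg s.x) (P.yStar (avg s.x))‖ ^ 2) ≤
      4 * (c.bf ^ 2 + lam ^ 2 * c.bg ^ 2)
      + 2 * c.Llam lam ^ 2 * (consensusError s.x + consensusError s.y
        + 2 * ‖avg s.y - P.yStarPen lam (avg s.x)‖ ^ 2 + 2 * (c.Cin / lam) ^ 2) := by
  have h := isBilevel hr ho hi
  set X := avg s.x with hX
  set q := P.yStar X with hq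
  have key : ∀ i, ‖hy P lam s i - penGrad (meanFun P.f) (meanFun P.g) lam X q‖ ^ 2 ≤
      4 * ‖gradY (P.f i) X q - gradY (meanFun P.f) X q‖ ^ 2
        + (4 * lam ^ 2 * ‖gradY (P.g i) X q - gradY (meanFun P.g) X q‖ ^ 2
        + 2 * c.Llam lam ^ 2 * (‖s.x i - X‖ ^ 2 + ‖s.y i - q‖ ^ 2)) := fun i => by
    have e : hy P lam s i - penGrad (meanFun P.f) (meanFun P.g) lam X q =
        ((gradY (P.f i) X q - gradY (meanFun P.f) X q) +
        lam • (gradY (P.g i) X q - gradY (meanFun P.g) X q)) +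
        (penGrad (P.f i) (P.g i) lam (s.x i) (s.y i) - penGrad (P.f i) (P.g i) lam X q) := by
      simp only [hy, penGrad]; module
    rw [e]
    refine (norm_add_sq_le_two _ _).trans ?_
    have h1 := norm_add_sq_le_two (gradY (P.f i) X q - gradY (meanFun P.f) X q)
      (lam • (gradY (P.g i) X q - gradY (meanFun P.g) X q))
    rw [norm_smul, mul_pow, Real.norm_eq_abs, sq_abs] at h1
    have h2 := norm_local_penGrad_sub_sq_le ho hi (h.lam_pos hl).le i (s.x i) X (s.y i) q
    linarith
  refine (avg_mono key).trans ?_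
  rw [avg_add, avg_add, avg_mul, avg_mul, avg_mul, avg_add, avg_norm_sub_sq_eq s.x,
    avg_norm_sub_sq_eq s.y, ← hX, sub_self, norm_zero]
  have h1 : avg (fun i => ‖gradY (P.f i) X q - gradY (meanFun P.f) X q‖ ^ 2) ≤ c.bf ^ 2 := hh.fy X
  have h1' : avg (fun i => ‖gradY (P.g i) X q - gradY (meanFun P.g) X q‖ ^ 2) ≤ c.bg ^ 2 :=
    hh.gy X
  have h2 := norm_avg_y_sub_yStar_sq_le h hl (avg s.y) X
  rw [← hq] at h2
  have h4 := mul_le_mul_of_nonneg_left h2 (show 0 ≤ 2 * c.Llam lam ^ 2 by positivity)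
  have h5 := mul_le_mul_of_nonneg_left h1' (show 0 ≤ 4 * lam ^ 2 by positivity)
  linarith

theorem avg_hz_sub_sq_le (hi : InnerAssumption P c) (hh : HeterogeneityAssumption P c) :
    avg (fun i => ‖hz P s i - gradY (meanFun P.g) (avg s.x) (P.yStar (avg s.x))‖ ^ 2) ≤
      2 * c.bg ^ 2 + 2 * c.Lg1 ^ 2 * (consensusError s.x + consensusError s.z
        + ‖avg s.z - P.yStar (avg s.x)‖ ^ 2) := by
  set X := avg s.x with hX
  set q := P.yStar X with hq
  have key : ∀ i, ‖hz P s i - gradY (meanFun P.g) X q‖ ^ 2 ≤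
      2 * ‖gradY (P.g i) X q - gradY (meanFun P.g) X q‖ ^ 2
        + 2 * c.Lg1 ^ 2 * (‖s.x i - X‖ ^ 2 + ‖s.z i - q‖ ^ 2) := fun i => by
    have h1 := norm_add_sq_le_two (gradY (P.g i) X q - gradY (meanFun P.g) X q)
      (gradY (P.g i) (s.x i) (s.z i) - gradY (P.g i) X q)
    have h2 := (hi.smooth i).gradY_sub_sq_le (s.x i) X (s.z i) q
    rw [add_comm, sub_add_sub_cancel, add_comm] at h1
    rw [hz]
    linarith
  refine (avg_mono key).trans ?_
  rw [avg_add, avg_mul, avg_mul, avg_add, avg_norm_sub_sq_eq s.x, avg_norm_sub_sq_eq s.z, ← hX, sub_self,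
    norm_zero]
  have h1 : avg (fun i => ‖gradY (P.g i) X q - gradY (meanFun P.g) X q‖ ^ 2) ≤ c.bg ^ 2 :=
    hh.gy X
  linarith

end Estimates

end AHEAD

/-! ### Consequences of the parameter and step-size conditions -/

namespace AHEAD

section Parameters

variable {n r : ℕ} {f g : Vec n → Vec r → ℝ} {c : Constants} {lam : ℝ}

namespace IsBilevel

theorem Lf1_sq_le (h : IsBilevel f g c) (hl : 2 * c.Lf1 / c.μg < lam) :
    c.Lf1 ^ 2 ≤ 1 / 4 * (lam ^ 2 * c.Lg1 ^ 2) := by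
  have h1 : c.Lf1 ≤ 1 / 2 * (lam * c.Lg1) := by
    have := mul_le_mul_of_nonneg_left h.μg_le (h.lam_pos hl).le
    linarith [h.Lf1_lt hl]
  have := pow_le_pow_left₀ h.Lf1_nonneg h1 2
  linarith

theorem Usq_le (h : IsBilevel f g c) (hl : 2 * c.Lf1 / c.μg < lam) :
    c.Usq lam ≤ 5 / 4 * (lam ^ 2 * c.Lg1 ^ 2) := by
  rw [Constants.Usq]; linarith [h.Lf1_sq_le hl]

theorem Llam_sq_le (h : IsBilevel f g c) (hl : 2 * c.Lf1 / c.μg < lam) :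
    c.Llam lam ^ 2 ≤ 9 / 4 * (lam ^ 2 * c.Lg1 ^ 2) := by
  have h0 : 0 ≤ c.Llam lam := by
    have := h.lam_pos hl
    have := h.Lg1_pos
    have := h.Lf1_nonneg
    rw [Constants.Llam]; positivity
  have := pow_le_pow_left₀ h0 (h.Llam_le hl) 2
  linarith

theorem wγ_pos (h : IsBilevel f g c) : 0 < c.wγ := by
  have := h.Lg1_pos
  have := h.μg_pos
  rw [Constants.wγ]; positivity

theorem wγ_le (h : IsBilevel f g c) : c.wγ ≤ c.μg / 2 := by
  have h1 := h.Lg1_pos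
  have h2 := h.μg_pos
  have : c.μg * c.Lg1 / (c.μg + c.Lg1) ≤ c.μg := by
    rw [div_le_iff₀ (by positivity)]; nlinarith
  rw [Constants.wγ]; linarith

theorem Lg1_le_wγ (h : IsBilevel f g c) : c.Lg1 ≤ 4 * c.LyStar * c.wγ := by
  have h1 := h.Lg1_pos
  have h2 := h.μg_pos
  have e : 4 * c.LyStar * c.wγ = 2 * c.Lg1 ^ 2 / (c.μg + c.Lg1) := by
    rw [Constants.LyStar, Constants.wγ]; field_simp; ring
  rw [e, le_div_iff₀ (by positivity)]
  nlinarith [h.μg_le]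

theorem two_μlam_le_Llam (h : IsBilevel f g c) (hl : 2 * c.Lf1 / c.μg < lam) :
    2 * c.μlam lam ≤ c.Llam lam := by
  have := mul_le_mul_of_nonneg_left h.μg_le (h.lam_pos hl).le
  rw [Constants.μlam, Constants.Llam]; linarith [h.Lf1_nonneg]

theorem Llam_pos (h : IsBilevel f g c) (hl : 2 * c.Lf1 / c.μg < lam) : 0 < c.Llam lam := by
  linarith [h.two_μlam_le_Llam hl, h.μlam_pos hl]

theorem wβ_pos (h : IsBilevel f g c) (hl : 2 * c.Lf1 / c.μg < lam) : 0 < c.wβ lam := by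
  have := h.μlam_pos hl
  have := h.Llam_pos hl
  rw [Constants.wβ]; positivity

theorem wβ_le (h : IsBilevel f g c) (hl : 2 * c.Lf1 / c.μg < lam) :
    c.wβ lam ≤ c.μlam lam / 2 := by
  have h1 := h.μlam_pos hl
  have h2 := h.Llam_pos hl
  have : c.μlam lam * c.Llam lam / (c.μlam lam + c.Llam lam) ≤ c.μlam lam := by
    rw [div_le_iff₀ (by positivity)]; nlinarith
  rw [Constants.wβ]; linarith

theorem lam_mul_μg_le_wβ (h : IsBilevel f g c) (hl : 2 * c.Lf1 / c.μg < lam) :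
    lam * c.μg ≤ 6 * c.wβ lam := by
  have h1 := h.μlam_pos hl
  have h2 := h.Llam_pos hl
  have h3 := h.two_μlam_le_Llam hl
  have : 2 / 3 * c.μlam lam ≤ c.μlam lam * c.Llam lam / (c.μlam lam + c.Llam lam) := by
    rw [le_div_iff₀ (by positivity)]; nlinarith
  have e : c.μlam lam = lam * c.μg / 2 := rfl
  rw [Constants.wβ]; linarith

theorem Llam_le_wβ (h : IsBilevel f g c) (hl : 2 * c.Lf1 / c.μg < lam) :
    c.Llam lam ≤ 8 * c.LyStar * c.wβ lam := by
  have h1 := h.μlam_pos hl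
  have h2 := h.Llam_pos hl
  have hk := h.one_le_LyStar
  have h3 : c.Llam lam ≤ (1 + 2 * c.LyStar) * c.μlam lam := by
    have := h.Lf1_lt hl
    rw [Constants.Llam, Constants.μlam, h.Lg1_eq]; linarith
  have e : 8 * c.LyStar * c.wβ lam =
      4 * c.LyStar * c.μlam lam * c.Llam lam / (c.μlam lam + c.Llam lam) := by
    rw [Constants.wβ]; ring
  rw [e, le_div_iff₀ (by positivity), mul_comm]
  refine mul_le_mul_of_nonneg_right ?_ h2.le
  nlinarith

theorem p2_eq (h : IsBilevel f g c) : c.p2 = (1536 * c.LyStar ^ 2 + 24) * c.Lg1 ^ 2 := by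
  have h1 := h.Lg1_pos
  have h2 := h.μg_pos
  rw [Constants.p2, Constants.uβ, Constants.LyStar]; field_simp; ring

theorem p3_eq (h : IsBilevel f g c) : c.p3 = (768 * c.LyStar ^ 2 + 12) * c.Lg1 ^ 2 := by
  have h1 := h.Lg1_pos
  have h2 := h.μg_pos
  rw [Constants.p3, Constants.uβ, Constants.LyStar]; field_simp; ring

theorem p2_le_p1 (c : Constants) : c.p2 ≤ c.p1 := by
  rw [Constants.p1, Constants.p2]
  gcongr
  exact le_add_of_nonneg_left (by positivity)

end IsBilevel

namespace StepSizeConditions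

variable {ρ : ℝ} {t : Tuning}

theorem rho_lt_one (hs : StepSizeConditions c ρ t) (h : IsBilevel f g c)
    (hl : 2 * c.Lf1 / c.μg < t.lam) : ρ < 1 := by
  have h1 := h.lam_pos hl
  have h2 := h.Lg1_pos
  have h3 := hs.α_pos.trans hs.α_lt₇
  rw [div_pos_iff_of_pos_right (by positivity)] at h3
  linarith

theorem β_mul_Llam_le (hs : StepSizeConditions c ρ t) (h : IsBilevel f g c)
    (hl : 2 * c.Lf1 / c.μg < t.lam) (hρ : 0 ≤ ρ) : t.β * c.Llam t.lam ≤ 1 / 16 := by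
  have h1 := h.lam_pos hl
  have h2 := h.Lg1_pos
  have h3 := hs.β_lt₅
  rw [lt_div_iff₀ (by positivity)] at h3
  have h4 := mul_le_mul_of_nonneg_left (h.Llam_le hl) hs.β_pos.le
  linarith

theorem γ_mul_Lg1_le (hs : StepSizeConditions c ρ t) (h : IsBilevel f g c) (hρ : 0 ≤ ρ) :
    t.γ * c.Lg1 ≤ 1 / 16 := by
  have h2 := h.Lg1_pos
  have h3 := hs.γ_lt₅
  rw [lt_div_iff₀ (by positivity)] at h3
  linarith

theorem α_le_wγ (hs : StepSizeConditions c ρ t) (h : IsBilevel f g c)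
    (hl : 2 * c.Lf1 / c.μg < t.lam) :
    16 * (t.α * (c.LyStar * c.Lg1 * t.lam)) ≤ c.wγ * t.γ := by
  have h1 := h.lam_pos hl
  have h2 := h.Lg1_pos
  have h4 := h.one_le_LyStar
  have h3 := hs.α_lt₃
  rw [lt_div_iff₀ (by positivity)] at h3
  linarith

/-- Chain: 16ακL_{g,1}λ ≤ w_γγ ≤ γL_{g,1}/2 ≤ 1/32. -/
theorem α_mul_le (hs : StepSizeConditions c ρ t) (h : IsBilevel f g c)
    (hl : 2 * c.Lf1 / c.μg < t.lam) (hρ : 0 ≤ ρ) :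
    t.α * (c.LyStar * c.Lg1 * t.lam) ≤ 1 / 512 := by
  have h1 := hs.α_le_wγ h hl
  have h2 := mul_le_mul_of_nonneg_right (h.wγ_le.trans (div_le_div_of_nonneg_right h.μg_le
    two_pos.le)) hs.γ_pos.le
  have h3 := hs.γ_mul_Lg1_le h hρ
  linarith

theorem α_le_β (hs : StepSizeConditions c ρ t) (h : IsBilevel f g c) :
    80 * c.LyStar ^ 2 * t.α ≤ t.β := by
  have h1 := h.Lg1_pos
  have h2 := h.μg_pos
  have h3 := hs.α_lt₄
  rw [div_mul_eq_mul_div, lt_div_iff₀ (by positivity)] at h3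
  rw [Constants.LyStar]
  have e : 80 * (c.Lg1 / c.μg) ^ 2 * t.α = t.α * (80 * c.Lg1 ^ 2) / c.μg ^ 2 := by
    field_simp
  rw [e, div_le_iff₀ (by positivity)]
  linarith

theorem mul_sq_div_sq_le {p τ δ k : ℝ} (hp : 0 < p) (hτ : 0 ≤ τ) (hk : 0 < k) (hδ : 0 < δ)
    (h : τ < δ / (k * √p)) : p * τ ^ 2 / δ ^ 2 ≤ 1 / k ^ 2 := by
  have h0 := Real.sqrt_pos.2 hp
  rw [lt_div_iff₀ (by positivity)] at h
  have h1 := pow_le_pow_left₀ (by positivity) h.le 2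
  rw [div_le_div_iff₀ (by positivity) (by positivity)]
  have h2 := Real.sq_sqrt hp.le
  have e : (τ * (k * √p)) ^ 2 = p * τ ^ 2 * k ^ 2 := by rw [mul_pow, mul_pow, h2]; ring
  linarith

theorem p1_coeff_le (hs : StepSizeConditions c ρ t) (h : IsBilevel f g c)
    (hl : 2 * c.Lf1 / c.μg < t.lam) :
    c.p1 * t.lam ^ 2 * t.α ^ 2 / (1 - ρ) ^ 2 ≤ 1 / 25 := by
  have h1 := h.lam_pos hl
  have hp : 0 < c.p1 := by
    refine lt_of_lt_of_le ?_ (IsBilevel.p2_le_p1 c)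
    have := h.Lg1_pos
    rw [h.p2_eq]; positivity
  have h3 := mul_sq_div_sq_le hp hs.α_pos.le (by positivity)
    (sub_pos.2 (hs.rho_lt_one h hl)) hs.α_lt₅
  rw [le_div_iff₀ (by positivity)] at h3
  have e : c.p1 * t.lam ^ 2 * t.α ^ 2 / (1 - ρ) ^ 2 =
    c.p1 * t.α ^ 2 / (1 - ρ) ^ 2 * (5 * t.lam) ^ 2 / 25 := by ring
  rw [e]; linarith

theorem p2_coeff_le (hs : StepSizeConditions c ρ t) (h : IsBilevel f g c)
    (hl : 2 * c.Lf1 / c.μg < t.lam) :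
    c.p2 * t.lam ^ 2 * t.β ^ 2 / (1 - ρ) ^ 2 ≤ 1 / 100 := by
  have h1 := h.lam_pos hl
  have hp : 0 < c.p2 := by
    have := h.Lg1_pos
    rw [h.p2_eq]; positivity
  have h3 := mul_sq_div_sq_le hp hs.β_pos.le (by positivity)
    (sub_pos.2 (hs.rho_lt_one h hl)) hs.β_lt₃
  rw [le_div_iff₀ (by positivity)] at h3
  have e : c.p2 * t.lam ^ 2 * t.β ^ 2 / (1 - ρ) ^ 2 =
    c.p2 * t.β ^ 2 / (1 - ρ) ^ 2 * (10 * t.lam) ^ 2 / 100 := by ring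
  rw [e]; linarith

theorem p3_coeff_le (hs : StepSizeConditions c ρ t) (h : IsBilevel f g c)
    (hl : 2 * c.Lf1 / c.μg < t.lam) :
    c.p3 * t.γ ^ 2 / (1 - ρ) ^ 2 ≤ 1 / 64 := by
  have hp : 0 < c.p3 := by
    have := h.Lg1_pos
    rw [h.p3_eq]; positivity
  have h3 := mul_sq_div_sq_le hp hs.γ_pos.le (by positivity)
    (sub_pos.2 (hs.rho_lt_one h hl)) hs.γ_lt₃
  norm_num at h3 ⊢
  exact h3

end StepSizeConditions

/-- Contribution of the penalty tracking error to the decrease of the potential. -/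
theorem weighted_penalty_tracking_le {ρ : ℝ} {t : Tuning} (hs : StepSizeConditions c ρ t)
    (h : IsBilevel f g c) (hl : 2 * c.Lf1 / c.μg < t.lam) {d d' e N : ℝ} (he : 0 ≤ e) (hN : 0 ≤ N)
    (hd : d' ≤ (1 - c.wβ t.lam * t.β) * d
      + 6 / 5 / (c.wβ t.lam * t.β) * (t.β ^ 2 * (c.Llam t.lam ^ 2 * e))
      + 3 / 5 / (c.wβ t.lam * t.β) * (9 * c.LyStar ^ 2 * (t.α ^ 2 * N))) :
    12 * c.Usq t.lam * t.α / (c.wβ t.lam * t.β) * d' -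
      12 * c.Usq t.lam * t.α / (c.wβ t.lam * t.β) * d ≤
      t.α * (-12 * c.Usq t.lam * d + 1152 * c.LyStar ^ 2 * (t.lam ^ 2 * c.Lg1 ^ 2) * e
        + 457 / 1000 * N) := by
  have hα := hs.α_pos
  have hβ := hs.β_pos
  have hw := h.wβ_pos hl
  have hl0 := h.lam_pos hl
  have hμ := h.μg_pos
  have hk := h.one_le_LyStar
  have hL := h.Llam_pos hl
  have hU0 : 0 ≤ c.Usq t.lam := by rw [Constants.Usq]; positivity
  set w := c.wβ t.lam with hwdef
  set κ := c.LyStar with hκ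
  have h1 := mul_le_mul_of_nonneg_left hd
    (show 0 ≤ 12 * c.Usq t.lam * t.α / (w * t.β) by positivity)
  have b1 : c.Usq t.lam * (c.Llam t.lam / w) ^ 2 ≤
      5 / 4 * (t.lam ^ 2 * c.Lg1 ^ 2) * (8 * κ) ^ 2 := by
    have : c.Llam t.lam / w ≤ 8 * κ := by rw [div_le_iff₀ hw]; exact h.Llam_le_wβ hl
    have hu := h.Usq_le hl
    gcongr
  -- Coefficient of the drift: β ≥ 80κ²α and 6w ≥ λμ_g cancel every constant. Times 324/5 it gives
  -- about 0.4556, whence 457/1000.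
  have b2 : c.Usq t.lam * κ ^ 2 * (t.α / (w * t.β)) ^ 2 ≤ 45 / 6400 := by
    have h2 : t.α / (w * t.β) ≤ 6 / (80 * κ ^ 2 * (t.lam * c.μg)) := by
      rw [div_le_div_iff₀ (by positivity) (by positivity)]
      have := mul_le_mul (h.lam_mul_μg_le_wβ hl) (hs.α_le_β h) (by positivity) (by positivity)
      linarith
    have h3 : c.Usq t.lam ≤ 5 / 4 * (t.lam ^ 2 * (κ * c.μg) ^ 2) := by
      rw [← h.Lg1_eq]; exact h.Usq_le hl
    calc c.Usq t.lam * κ ^ 2 * (t.α / (w * t.β)) ^ 2 ≤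
        5 / 4 * (t.lam ^ 2 * (κ * c.μg) ^ 2) * κ ^ 2 * (6 / (80 * κ ^ 2 * (t.lam * c.μg))) ^ 2 := by
          gcongr
      _ = 45 / 6400 := by field_simp; norm_num
  have c1 := mul_le_mul_of_nonneg_right b1 (show 0 ≤ t.α * e by positivity)
  have c2 := mul_le_mul_of_nonneg_right b2 (show 0 ≤ t.α * N by positivity)
  have e1 : 12 * c.Usq t.lam * t.α / (w * t.β) * ((1 - w * t.β) * d
      + 6 / 5 / (w * t.β) * (t.β ^ 2 * (c.Llam t.lam ^ 2 * e))
      + 3 / 5 / (w * t.β) * (9 * κ ^ 2 * (t.α ^ 2 * N))) =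
      12 * c.Usq t.lam * t.α / (w * t.β) * d - 12 * c.Usq t.lam * (t.α * d)
      + 72 / 5 * (c.Usq t.lam * (c.Llam t.lam / w) ^ 2 * (t.α * e))
      + 324 / 5 * (c.Usq t.lam * κ ^ 2 * (t.α / (w * t.β)) ^ 2 * (t.α * N)) := by
    field_simp
    ring
  rw [e1] at h1
  have : 0 ≤ t.α * N := by positivity
  linarith

/-- Contribution of the lower-level tracking error to the decrease of the potential. -/
theorem weighted_lower_tracking_le {ρ : ℝ} {t : Tuning} (hs : StepSizeConditions c ρ t)
    (h : IsBilevel f g c) (hl : 2 * c.Lf1 / c.μg < t.lam) {d d' e N : ℝ} (he : 0 ≤ e) (hN : 0 ≤ N)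
    (hd : d' ≤ (1 - c.wγ * t.γ) * d
      + 6 / 5 / (c.wγ * t.γ) * (t.γ ^ 2 * (c.Lg1 ^ 2 * e))
      + 3 / 5 / (c.wγ * t.γ) * (c.LyStar ^ 2 * (t.α ^ 2 * N))) :
    12 * c.Lg1 ^ 2 * t.lam ^ 2 * t.α / (c.wγ * t.γ) * d' -
      12 * c.Lg1 ^ 2 * t.lam ^ 2 * t.α / (c.wγ * t.γ) * d ≤
      t.α * (-12 * (t.lam ^ 2 * c.Lg1 ^ 2) * d
        + 231 * c.LyStar ^ 2 * (t.lam ^ 2 * c.Lg1 ^ 2) * e + 29 / 1000 * N) := by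
  have hα := hs.α_pos
  have hγ := hs.γ_pos
  have hw := h.wγ_pos
  have hl0 := h.lam_pos hl
  have hk := h.one_le_LyStar
  have hL := h.Lg1_pos
  set w := c.wγ with hwdef
  set κ := c.LyStar with hκ
  have h1 := mul_le_mul_of_nonneg_left hd
    (show 0 ≤ 12 * c.Lg1 ^ 2 * t.lam ^ 2 * t.α / (w * t.γ) by positivity)
  have b1 : t.lam ^ 2 * c.Lg1 ^ 2 * (c.Lg1 / w) ^ 2 ≤
      t.lam ^ 2 * c.Lg1 ^ 2 * (4 * κ) ^ 2 := by
    have : c.Lg1 / w ≤ 4 * κ := by rw [div_le_iff₀ hw]; exact h.Lg1_le_wγ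
    gcongr
  -- Times 36/5 this is 0.028125, whence 29/1000; together with 457/1000 from the penalized problem
  -- it stays below the available ½‖d‖².
  have b2 : t.lam ^ 2 * c.Lg1 ^ 2 * κ ^ 2 * (t.α / (w * t.γ)) ^ 2 ≤ 1 / 256 := by
    have h2 : t.α / (w * t.γ) ≤ 1 / (16 * (κ * c.Lg1 * t.lam)) := by
      rw [div_le_div_iff₀ (by positivity) (by positivity)]
      linarith [hs.α_le_wγ h hl]
    calc t.lam ^ 2 * c.Lg1 ^ 2 * κ ^ 2 * (t.α / (w * t.γ)) ^ 2 ≤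
        t.lam ^ 2 * c.Lg1 ^ 2 * κ ^ 2 * (1 / (16 * (κ * c.Lg1 * t.lam))) ^ 2 := by gcongr
      _ = 1 / 256 := by field_simp; norm_num
  have c1 := mul_le_mul_of_nonneg_right b1 (show 0 ≤ t.α * e by positivity)
  have c2 := mul_le_mul_of_nonneg_right b2 (show 0 ≤ t.α * N by positivity)
  have e1 : 12 * c.Lg1 ^ 2 * t.lam ^ 2 * t.α / (w * t.γ) * ((1 - w * t.γ) * d
      + 6 / 5 / (w * t.γ) * (t.γ ^ 2 * (c.Lg1 ^ 2 * e))
      + 3 / 5 / (w * t.γ) * (κ ^ 2 * (t.α ^ 2 * N))) =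
      12 * c.Lg1 ^ 2 * t.lam ^ 2 * t.α / (w * t.γ) * d
      - 12 * (t.lam ^ 2 * c.Lg1 ^ 2) * (t.α * d)
      + 72 / 5 * (t.lam ^ 2 * c.Lg1 ^ 2 * (c.Lg1 / w) ^ 2 * (t.α * e))
      + 36 / 5 * (t.lam ^ 2 * c.Lg1 ^ 2 * κ ^ 2 * (t.α / (w * t.γ)) ^ 2 * (t.α * N)) := by
    field_simp
    ring
  rw [e1] at h1
  have h3 : 0 ≤ t.α * N := by positivity
  have h4 : 0 ≤ κ ^ 2 * (t.lam ^ 2 * c.Lg1 ^ 2) * (t.α * e) := by positivity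
  linarith

/-- Contribution of a consensus error to the decrease of the potential. -/
theorem weighted_consensus_le {p α lam ρ τ v v' H : ℝ} (hp : 0 ≤ p) (hα : 0 ≤ α) (hρ : ρ < 1)
    (hv : v' ≤ (1 + ρ) / 2 * v + 2 / (1 - ρ) * τ ^ 2 * H) :
    4 * p * α * lam ^ 2 / (1 - ρ) * v' - 4 * p * α * lam ^ 2 / (1 - ρ) * v ≤
      α * (-2 * (p * lam ^ 2) * v + 8 * (p * lam ^ 2 * τ ^ 2 / (1 - ρ) ^ 2) * H) := by
  have h0 : 0 < 1 - ρ := sub_pos.2 hρ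
  have h1 := mul_le_mul_of_nonneg_left hv
    (show 0 ≤ 4 * p * α * lam ^ 2 / (1 - ρ) by positivity)
  refine (sub_le_sub_right h1 _).trans (le_of_eq ?_)
  field_simp
  ring

end Parameters

/-- The balance of all error terms in one iteration. -/
theorem error_balance {G N X Y Z Dy Dz M U a κ lam E Lf Ll η₁ η₂ η₃ bf bg Hx Hy Hz p₁ p₃ Q : ℝ}
    (hN : 0 ≤ N) (hX : 0 ≤ X) (hY : 0 ≤ Y) (hZ : 0 ≤ Z) (hDy : 0 ≤ Dy) (hDz : 0 ≤ Dz)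
    (ha : 0 ≤ a) (hE : 0 ≤ E) (hκ : 0 ≤ κ) (hUa : a ≤ U) (hU : U ≤ 5 / 4 * a)
    (hLf : Lf ≤ 1 / 4 * a) (hLl : Ll ≤ 9 / 4 * a)
    (hη₁ : 0 ≤ η₁) (hη₁' : η₁ ≤ 1 / 25) (hη₂ : 0 ≤ η₂) (hη₂' : η₂ ≤ 1 / 100)
    (hη₃ : 0 ≤ η₃) (hη₃' : η₃ ≤ 1 / 64 * lam) (hlam : 0 ≤ lam) (hbf : 0 ≤ bf) (hbg : 0 ≤ bg)
    {ℓ : ℝ} (hℓ : 0 ≤ ℓ) (haℓ : a = lam * ℓ)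
    (hM : M ≤ 3 * U * (X + Y + Dy) + 3 * a * (X + Z + Dz))
    (hHx : Hx ≤ 3 * bf + 3 * Lf * (X + Y + 2 * Dy + 2 * E)
      + 3 * a * (2 * Y + 2 * Z + 3 * Dy + 3 * Dz + 3 * E))
    (hHy : Hy ≤ 4 * (bf + lam * bg) + 2 * Ll * (X + Y + 2 * Dy + 2 * E))
    (hHz : Hz ≤ 2 * bg + 2 * ℓ * (X + Z + Dz))
    (hp₁ : (1536 * κ + 24) * a ≤ p₁) (hp₃ : p₃ = (768 * κ + 12) * a) :
    (-G - 1 / 2 * N + Q + 2 * M) + (-12 * U * Dy + 1152 * κ * a * (X + Y) + 457 / 1000 * N)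
      + (-12 * a * Dz + 231 * κ * a * (X + Z) + 29 / 1000 * N)
      + (-2 * p₁ * X + 8 * η₁ * Hx) + (-2 * p₃ * Y + 8 * (η₂ / 2) * Hy)
      + (-2 * p₃ * Z + 8 * η₃ * Hz) ≤
    -G + Q + (864 * η₁ + 576 * η₂) * (a * E)
      + (24 * η₁ * bf + 48 * η₂ * (bf + lam * bg) + 24 * η₃ * bg) := by
  have x1 : Hx ≤ 3 * bf + 21 / 2 * (a * E) + a * (3 / 4 * X + 27 / 4 * Y + 6 * Z + 21 / 2 * Dy
      + 9 * Dz) := by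
    have := mul_le_mul_of_nonneg_right hLf (show 0 ≤ X + Y + 2 * Dy + 2 * E by positivity)
    linarith
  have y1 : Hy ≤ 4 * (bf + lam * bg) + 9 * (a * E) + a * (9 / 2 * X + 9 / 2 * Y + 9 * Dy) := by
    have := mul_le_mul_of_nonneg_right hLl (show 0 ≤ X + Y + 2 * Dy + 2 * E by positivity)
    linarith
  have x2 := mul_le_mul_of_nonneg_left x1 hη₁
  have y2 := mul_le_mul_of_nonneg_left y1 hη₂
  have z2 := mul_le_mul_of_nonneg_left hHz hη₃
  have x3 := mul_le_mul_of_nonneg_right hη₁' (show 0 ≤ a * (3 / 4 * X + 27 / 4 * Y + 6 * Z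
    + 21 / 2 * Dy + 9 * Dz) by positivity)
  have y3 := mul_le_mul_of_nonneg_right hη₂' (show 0 ≤ a * (9 / 2 * X + 9 / 2 * Y + 9 * Dy) by
    positivity)
  have z3 : η₃ * (2 * ℓ * (X + Z + Dz)) ≤ 1 / 32 * (a * (X + Z + Dz)) := by
    have := mul_le_mul_of_nonneg_right hη₃' (show 0 ≤ 2 * ℓ * (X + Z + Dz) by positivity)
    rw [haℓ]; linarith
  have u1 := mul_le_mul_of_nonneg_right hU (show 0 ≤ X + Y by positivity)
  have u2 := mul_le_mul_of_nonneg_right hUa hDy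
  have q1 := mul_le_mul_of_nonneg_right hp₁ hX
  have n1 : 0 ≤ a * X := by positivity
  have n2 : 0 ≤ a * Y := by positivity
  have n3 : 0 ≤ a * Z := by positivity
  have n4 : 0 ≤ a * Dy := by positivity
  have n5 : 0 ≤ a * Dz := by positivity
  have n6 : 0 ≤ κ * a * X := by positivity
  have n7 : 0 ≤ κ * a * Y := by positivity
  have n8 : 0 ≤ κ * a * Z := by positivity
  have m1 : 0 ≤ η₁ * (a * E) := by positivity
  have m2 : 0 ≤ η₂ * (a * E) := by positivity
  have m3 : 0 ≤ η₂ * (bf + lam * bg) := by positivity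
  have m4 : 0 ≤ η₃ * bg := by positivity
  -- Each error now has a nonpositive total coefficient: N by 457/1000 + 29/1000 < 1/2; Dy and Dz
  -- because half of their −12 pays for 2M and the rest exceeds the feedback through Hx, Hy, Hz; X,
  -- Y, Z by −2p₁ and −2p₃.
  rw [hp₃]
  linarith

end AHEAD

/-! ### Decrease of the potential -/

namespace AHEAD

/-- Decrease of the potential in one iteration. -/
theorem potential_step_le {m n r : ℕ} [NeZero m] (hr : 1 ≤ r) {P : Problem m n r} {c : Constants}
    {W : Matrix (Fin m) (Fin m) ℝ} {t : Tuning}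
    (ho : OuterAssumption P c) (hi : InnerAssumption P c) (hW : W ∈ doublyStochastic ℝ (Fin m))
    (hh : HeterogeneityAssumption P c) (hl : 2 * c.Lf1 / c.μg < t.lam)
    (hs : StepSizeConditions c (rho W) t) (s : State m n r) :
    potential P c (rho W) t (step P W t s) - potential P c (rho W) t s ≤
      t.α * (-‖∇ P.Phi (avg s.x)‖ ^ 2 + penaltyErrors c (rho W) t
        + heterogeneityErrors c (rho W) t) := by
  have h := isBilevel hr ho hi
  have hρ0 : 0 ≤ rho W := sq_nonneg _
  have hρ1 := hs.rho_lt_one h hl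
  have hl0 := h.lam_pos hl
  have hα := hs.α_pos
  have hLg := h.Lg1_pos
  have hp3 : 0 ≤ c.p3 := by rw [h.p3_eq]; positivity
  have hp2 : 0 ≤ c.p2 := by rw [h.p2_eq]; positivity
  have hp1 : 0 ≤ c.p1 := hp2.trans (IsBilevel.p2_le_p1 c)
  have hx' : avg (step P W t s).x = avg s.x - t.α • avg (hx P t.lam s) := avg_mixing_sub hW _ _ _
  have hy' : avg (step P W t s).y = avg s.y - t.β • avg (hy P t.lam s) := avg_mixing_sub hW _ _ _
  have hz' : avg (step P W t s).z = avg s.z - t.γ • avg (hz P s) := avg_mixing_sub hW _ _ _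
  have cX := consensusError_nonneg s.x
  have cY := consensusError_nonneg s.y
  have cZ := consensusError_nonneg s.z
  have tΦ := h.hyperobjective_descent hl hα (hs.α_mul_le h hl hρ0) (avg s.x) (avg (hx P t.lam s))
  have tY := weighted_penalty_tracking_le hs h hl (add_nonneg cX cY)
    (sq_nonneg ‖avg (hx P t.lam s)‖)
    (h.penalty_tracking hl hs.β_pos (hs.β_mul_Llam_le h hl hρ0) (h.wβ_pos hl) (h.wβ_le hl)
      (α := t.α) (avg s.x) (avg (hx P t.lam s)) (avg s.y) (avg (hy P t.lam s))
      (norm_avg_hy_sub_sq_le s ho hi hl0.le))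
  have tZ := weighted_lower_tracking_le hs h hl (add_nonneg cX cZ)
    (sq_nonneg ‖avg (hx P t.lam s)‖)
    (h.lower_tracking hs.γ_pos (hs.γ_mul_Lg1_le h hρ0) h.wγ_pos h.wγ_le
      (α := t.α) (avg s.x) (avg (hx P t.lam s)) (avg s.z) (avg (hz P s))
      (norm_avg_hz_sub_sq_le s hi))
  have kX := weighted_consensus_le (lam := t.lam) hp1 hα.le hρ1
    (consensusError_mixing_sub_le hW hρ1 s.x (hx P t.lam s) t.α
      (gradX (meanFun P.f) (avg s.x) (P.yStar (avg s.x))))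
  have kY := weighted_consensus_le (lam := t.lam) hp3 hα.le hρ1
    (consensusError_mixing_sub_le hW hρ1 s.y (hy P t.lam s) t.β
      (penGrad (meanFun P.f) (meanFun P.g) t.lam (avg s.x) (P.yStar (avg s.x))))
  have kZ := weighted_consensus_le (lam := t.lam) hp3 hα.le hρ1
    (consensusError_mixing_sub_le hW hρ1 s.z (hz P s) t.γ
      (gradY (meanFun P.g) (avg s.x) (P.yStar (avg s.x))))
  -- The balance is linear in squared quantities: its κ, lam, ℓ, bf, bg stand for κ², λ², L_{g,1}²,
  -- b_f², b_g², and p₁, p₃ carry a factor λ².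
  have bal := error_balance (G := ‖∇ P.Phi (avg s.x)‖ ^ 2)
    (Q := 2 * c.Cou ^ 2 / t.lam ^ 2) (κ := c.LyStar ^ 2) (lam := t.lam ^ 2) (ℓ := c.Lg1 ^ 2)
    (a := t.lam ^ 2 * c.Lg1 ^ 2) (U := c.Usq t.lam) (Lf := c.Lf1 ^ 2) (Ll := c.Llam t.lam ^ 2)
    (bf := c.bf ^ 2) (bg := c.bg ^ 2) (E := (c.Cin / t.lam) ^ 2)
    (p₁ := c.p1 * t.lam ^ 2) (p₃ := c.p3 * t.lam ^ 2)
    (η₁ := c.p1 * t.lam ^ 2 * t.α ^ 2 / (1 - rho W) ^ 2)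
    (η₂ := c.p2 * t.lam ^ 2 * t.β ^ 2 / (1 - rho W) ^ 2)
    (η₃ := c.p3 * t.γ ^ 2 / (1 - rho W) ^ 2 * t.lam ^ 2)
    (sq_nonneg ‖avg (hx P t.lam s)‖) cX cY cZ
    (sq_nonneg ‖avg s.y - P.yStarPen t.lam (avg s.x)‖)
    (sq_nonneg ‖avg s.z - P.yStar (avg s.x)‖) (by positivity) (sq_nonneg _) (sq_nonneg _)
    (by rw [Constants.Usq]; exact le_add_of_nonneg_left (sq_nonneg _)) (h.Usq_le hl)
    (h.Lf1_sq_le hl) (h.Llam_sq_le hl) (by positivity) (hs.p1_coeff_le h hl) (by positivity)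
    (hs.p2_coeff_le h hl) (by positivity)
    (mul_le_mul_of_nonneg_right (hs.p3_coeff_le h hl) (sq_nonneg _)) (sq_nonneg _) (sq_nonneg _)
    (sq_nonneg _) (sq_nonneg _) rfl
    (norm_avg_hx_sub_sq_le s ho hi) (avg_hx_sub_sq_le s hr ho hi hh hl)
    (avg_hy_sub_sq_le s hr ho hi hh hl) (avg_hz_sub_sq_le s hi hh)
    (by
      have := mul_le_mul_of_nonneg_right (h.p2_eq ▸ IsBilevel.p2_le_p1 c) (sq_nonneg t.lam)
      linarith)
    (by rw [h.p3_eq]; ring)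
  have bal' := mul_le_mul_of_nonneg_left bal hα.le
  -- The consensus error of y is weighted by p₃ = p₂/2, whereas the step-size condition on β and the
  -- error terms use p₂.
  have e2 : c.p3 * t.lam ^ 2 * t.β ^ 2 / (1 - rho W) ^ 2 =
      c.p2 * t.lam ^ 2 * t.β ^ 2 / (1 - rho W) ^ 2 / 2 := by rw [h.p3_eq, h.p2_eq]; ring
  have e3 : c.p3 * t.lam ^ 2 * t.γ ^ 2 / (1 - rho W) ^ 2 =
      c.p3 * t.γ ^ 2 / (1 - rho W) ^ 2 * t.lam ^ 2 := by ring
  -- The distance C_in/λ between the two minimizers exactly compensates the factor λ of the penalty.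
  have e4 : t.lam ^ 2 * c.Lg1 ^ 2 * (c.Cin / t.lam) ^ 2 = c.Cin ^ 2 * c.Lg1 ^ 2 := by
    field_simp
  rw [e2] at kY
  rw [e3] at kZ
  rw [e4] at bal'
  rw [← hx', ← hy', ← yStarPen_eq, ← yStarPen_eq] at tY
  rw [← hx', ← hz'] at tZ
  rw [← hx'] at tΦ
  change _ ≤ t.α * (-‖∇ P.Phi (avg s.x)‖ ^ 2 - _ + _ + _) at tΦ
  have eP : penaltyErrors c (rho W) t + heterogeneityErrors c (rho W) t =
      2 * c.Cou ^ 2 / t.lam ^ 2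
      + (864 * (c.p1 * t.lam ^ 2 * t.α ^ 2 / (1 - rho W) ^ 2)
        + 576 * (c.p2 * t.lam ^ 2 * t.β ^ 2 / (1 - rho W) ^ 2)) * (c.Cin ^ 2 * c.Lg1 ^ 2)
      + (24 * (c.p1 * t.lam ^ 2 * t.α ^ 2 / (1 - rho W) ^ 2) * c.bf ^ 2
        + 48 * (c.p2 * t.lam ^ 2 * t.β ^ 2 / (1 - rho W) ^ 2) * (c.bf ^ 2 + t.lam ^ 2 * c.bg ^ 2)
        + 24 * (c.p3 * t.γ ^ 2 / (1 - rho W) ^ 2 * t.lam ^ 2) * c.bg ^ 2) := by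
    rw [penaltyErrors, heterogeneityErrors]; ring
  rw [add_assoc, eP]
  have eV : potential P c (rho W) t (step P W t s) - potential P c (rho W) t s =
      2 * (P.Phi (avg (step P W t s).x) - P.Phi (avg s.x))
      + (12 * c.Usq t.lam * t.α / (c.wβ t.lam * t.β) *
          ‖avg (step P W t s).y - P.yStarPen t.lam (avg (step P W t s).x)‖ ^ 2 -
        12 * c.Usq t.lam * t.α / (c.wβ t.lam * t.β) *
          ‖avg s.y - P.yStarPen t.lam (avg s.x)‖ ^ 2)
      + (12 * c.Lg1 ^ 2 * t.lam ^ 2 * t.α / (c.wγ * t.γ) *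
          ‖avg (step P W t s).z - P.yStar (avg (step P W t s).x)‖ ^ 2 -
        12 * c.Lg1 ^ 2 * t.lam ^ 2 * t.α / (c.wγ * t.γ) *
          ‖avg s.z - P.yStar (avg s.x)‖ ^ 2)
      + (4 * c.p1 * t.α * t.lam ^ 2 / (1 - rho W) * consensusError (step P W t s).x -
        4 * c.p1 * t.α * t.lam ^ 2 / (1 - rho W) * consensusError s.x)
      + (4 * c.p3 * t.α * t.lam ^ 2 / (1 - rho W) * consensusError (step P W t s).y -
        4 * c.p3 * t.α * t.lam ^ 2 / (1 - rho W) * consensusError s.y)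
      + (4 * c.p3 * t.α * t.lam ^ 2 / (1 - rho W) * consensusError (step P W t s).z -
        4 * c.p3 * t.α * t.lam ^ 2 / (1 - rho W) * consensusError s.z) := by
    rw [potential, potential]; ring
  rw [eV]
  refine (add_le_add (add_le_add (add_le_add (add_le_add (add_le_add tΦ tY) tZ) kX) kY) kZ).trans ?_
  refine le_trans (le_of_eq ?_) (bal'.trans (le_of_eq ?_))
  · rw [← mul_add, ← mul_add, ← mul_add, ← mul_add, ← mul_add]
    congr 1
  · ring

end AHEAD

/-! ### Telescoping of the potential -/

theorem theorem1 {m n r : ℕ} (hr : 1 ≤ r)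
    (P : AHEAD.Problem m n r) (c : AHEAD.Constants)
    (G : SimpleGraph (Fin m)) (W : Matrix (Fin m) (Fin m) ℝ) (t : AHEAD.Tuning)
    (h_outer : AHEAD.OuterAssumption P c) (h_inner : AHEAD.InnerAssumption P c)
    (h_network : AHEAD.NetworkAssumption G W) (h_het : AHEAD.HeterogeneityAssumption P c)
    (h_lam : 2 * c.Lf1 / c.μg < t.lam)
    (h_step : AHEAD.StepSizeConditions c (AHEAD.rho W) t)
    (s₀ : AHEAD.State m n r) (K : ℕ) (hK : 1 ≤ K) :
    Differentiable ℝ P.Phi ∧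
    1 / (K : ℝ) * ∑ k ∈ Finset.range K,
        ‖gradient P.Phi (AHEAD.avg (AHEAD.iter P W t s₀ k).x)‖ ^ 2 ≤
      (AHEAD.potential P c (AHEAD.rho W) t (AHEAD.iter P W t s₀ 0)
          - AHEAD.potential P c (AHEAD.rho W) t (AHEAD.iter P W t s₀ K)) / (t.α * K)
        + AHEAD.penaltyErrors c (AHEAD.rho W) t
        + AHEAD.heterogeneityErrors c (AHEAD.rho W) t := by
  have hne : Nonempty (Fin m) := h_network.connected.nonempty
  -- m ≥ 1 follows from connectedness, which includes nonemptiness.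
  have : NeZero m := ⟨fun hm => by subst hm; exact hne.elim fun i => i.elim0⟩
  refine ⟨(AHEAD.isBilevel hr h_outer h_inner).differentiable_hyperobjective, ?_⟩
  have hα := h_step.α_pos
  have hK0 : (0 : ℝ) < K := by exact_mod_cast hK
  set V : ℕ → ℝ := fun k => AHEAD.potential P c (AHEAD.rho W) t (AHEAD.iter P W t s₀ k) with hV
  set C := AHEAD.penaltyErrors c (AHEAD.rho W) t + AHEAD.heterogeneityErrors c (AHEAD.rho W) t
    with hC
  have hstep : ∀ k, t.α * ‖gradient P.Phi (AHEAD.avg (AHEAD.iter P W t s₀ k).x)‖ ^ 2 ≤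
      (V k - V (k + 1)) + t.α * C := fun k => by
    have h1 := AHEAD.potential_step_le hr h_outer h_inner h_network.doublyStochastic h_het h_lam
      h_step (AHEAD.iter P W t s₀ k)
    change V (k + 1) - V k ≤ _ at h1
    rw [hC]
    linarith
  have hsum := Finset.sum_le_sum fun k (_ : k ∈ Finset.range K) => hstep k
  rw [← Finset.mul_sum, Finset.sum_add_distrib, Finset.sum_range_sub', Finset.sum_const,
    Finset.card_range, nsmul_eq_mul] at hsum
  rw [add_assoc, ← hC, div_add' _ _ _ (by positivity), one_div, inv_mul_eq_div,
    div_le_div_iff₀ hK0 (by positivity)]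
  nlinarith
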